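/- For $c>0$ let $\chi_{[0,c)}$ be the characteristic function of $[0,c)$. For $a,b>0$ let $\mathcal G(\chi_{[0,c)},a\mathbb Z\times\mathbb Z/b)=\{e^{-2\pi i nt/b}\chi_{[0,c)}(t-ma):(m,n)\in\mathbb Z\times\mathbb Z\}$ be the associated Gabor system. It is called a Gabor frame if it is a frame for $L^2(\mathbb R)$, i.e. if there are constants $A,B>0$ such that $A\|f\|_2^2\le\sum_{m,n\in\mathbb Z}|\langle f,e^{-2\pi i n\cdot/b}\chi_{[0,c)}(\cdot-ma)\rangle|^2\le B\|f\|_2^2$ for all $f\in L^2(\mathbb R)$. Let $a,b,c$ be real numbers with $0<a<b<c$, and set $k=\lfloor c/b\rfloor$ and $c_0=c-kb$. Then the following statements hold. (V) If $c_0\ge a$ and $c_0\le b-a$, then $\mathcal G(\chi_{[0,c)},a\mathbb Z\times\mathbb Z/b)$ is a Gabor frame. (VI) If $c_0\ge a$ and $c_0>b-a$, then $\mathcal G(\chi_{[0,c)},a\mathbb Z\times\mathbb Z/b)$ is not a Gabor frame if and only if $a/b=p/q$ for some coprime positive integers $p,q$ such that either 1) $c_0>b-\gcd(k+1,p)\,b/q$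 and $\gcd(k+1,p)\ne k+1$, or 2) $c_0>b-\gcd(k+1,p)\,b/q+b/q$ and $\gcd(k+1,p)=k+1$. (VII) If $c_0<a$ and $c_0\le b-a$, then $\mathcal G(\chi_{[0,c)},a\mathbb Z\times\mathbb Z/b)$ is not a Gabor frame if and only if one of the following holds: 3) $c_0=0$; 4) $a/b=p/q$ for some coprime positive integers $p,q$ such that $0<c_0<\gcd(k,p)\,b/q$ and $\gcd(k,p)\ne k$; 5) $a/b=p/q$ for some coprime positive integers $p,q$ such that $0<c_0<\gcd(k,p)\,b/q-b/q$ and $\gcd(k,p)=k$. -/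

import Mathlib

open MeasureTheory

noncomputable section

/-- A family `g` in a complex Hilbert space is a frame: there are constants `0 < A` and `0 < B` with
`A ‖f‖² ≤ ∑ i, |⟨g i, f⟩|² ≤ B ‖f‖²` for all `f`, the sum being convergent. -/
def IsFrame {H ι : Type*} [NormedAddCommGroup H] [InnerProductSpace ℂ H] (g : ι → H) : Prop :=
  ∃ A B : ℝ, 0 < A ∧ 0 < B ∧ ∀ f : H,
    Summable (fun i => ‖inner ℂ (g i) f‖ ^ 2) ∧
    A * ‖f‖ ^ 2 ≤ ∑' i, ‖inner ℂ (g i) f‖ ^ 2 ∧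
    ∑' i, ‖inner ℂ (g i) f‖ ^ 2 ≤ B * ‖f‖ ^ 2

/-- The time-frequency shift `t ↦ exp (-2 π i n t / b) φ (t - m a)` of a function `φ`. -/
def timeFreqShift (φ : ℝ → ℂ) (a b : ℝ) (m n : ℤ) (t : ℝ) : ℂ :=
  Complex.exp (-2 * Real.pi * Complex.I * n * t / b) * φ (t - m * a)

theorem timeFreqShift_memLp {φ : ℝ → ℂ} (hφ : MemLp φ 2 volume) (a b : ℝ) (m n : ℤ) :
    MemLp (timeFreqShift φ a b m n) 2 volume := by
  have h1 : MemLp (fun t : ℝ => φ (t - m * a)) 2 volume :=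
    hφ.comp_measurePreserving (measurePreserving_sub_right volume (m * a : ℝ))
  have hcont : Continuous fun t : ℝ =>
      Complex.exp (-2 * Real.pi * Complex.I * n * t / b) := by fun_prop
  refine h1.of_le (hcont.aestronglyMeasurable.mul h1.aestronglyMeasurable)
    (Filter.Eventually.of_forall fun t => ?_)
  have h2 : (-2 * Real.pi * Complex.I * n * t / b : ℂ)
      = ((-2 * Real.pi * n * t / b : ℝ) : ℂ) * Complex.I := by
    push_cast
    ring
  simp only [timeFreqShift, norm_mul, h2, Complex.norm_exp_ofReal_mul_I, one_mul, le_refl]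

/-- The Gabor system `{exp (-2 π i n t / b) φ (t - m a) : (m, n) ∈ ℤ × ℤ}` in `L²(ℝ)` generated by
the window `φ ∈ L²(ℝ)` and the lattice `aℤ × ℤ/b`. -/
def gaborSystem (φ : Lp ℂ 2 (volume : Measure ℝ)) (a b : ℝ) :
    ℤ × ℤ → Lp ℂ 2 (volume : Measure ℝ) :=
  fun mn => (timeFreqShift_memLp (Lp.memLp φ) a b mn.1 mn.2).toLp _

/-- The Gabor system of `φ` over `aℤ × ℤ/b` is a frame for `L²(ℝ)`. -/
def IsGaborFrame (φ : Lp ℂ 2 (volume : Measure ℝ)) (a b : ℝ) : Prop :=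
  IsFrame (gaborSystem φ a b)

/-- The ideal window, that is, the characteristic function of `[0, c)`, as an element of `L²(ℝ)`. -/
def idealWindow (c : ℝ) : Lp ℂ 2 (volume : Measure ℝ) :=
  indicatorConstLp 2 (measurableSet_Ico : MeasurableSet (Set.Ico 0 c))
    measure_Ico_lt_top.ne (1 : ℂ)

end

open MeasureTheory

/-! ### Windows of the lattice `t + bℤ` -/

/-! Folding the line with period `b` turns the inner products with fixed `m` into Fourier
coefficients. By Parseval, the frame sum of `f` is `b` times the integral, over `t` in one period,
of the energy of the sums of `j ↦ f (t + j b)` over the windows `[m a, m a + c)`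
(`tsum_inner_gaborSystem_sq`). The question becomes whether a sequence `v` on `ℤ` is stably
determined by its window sums, uniformly in `t`.

A window with first index `j` has `k + 1` entries if `t + j b - m a` lies in `[0, c₀)`, and `k`
entries if it lies in `[c₀, b)`. If `a ≤ c₀`, every block of `k + 1` indices is a window; if `c₀ ≤ b
- a`, every block of `k` is. Let `K` be such a length. The `K`-block sums determine `v` up to a
`K`-periodic sequence with zero sum over a period. Where blocks of both lengths start at the same
index, subtraction yields a single entry `v j`; this happens when `t + j b` modulo `a` meets an
interval of length `L`, with `L = b - c₀` for `K = k + 1` and `L = c₀` for `K = k`. The system is a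
frame if these entries meet, within boundedly many steps, all classes modulo `K` but at most one
(`isGaborFrame_of_meetsClasses`). It is not a frame if two classes are missed for an interval of
`t`, because all windows then annihilate the difference of their indicators
(`MissesTwoClasses.not_isGaborFrame`).

Along one class, `t + j b` modulo `a` moves by the group generated by `K b` and `a`. This group is
dense if `a / b` is irrational, and has spacing `d b / q` with `d = gcd (K, p)` if `a / b = p / q`
in lowest terms. Comparing `L` with the spacing gives `exists_meetsClasses_or_obstruction` and
`Obstruction.missesTwoClasses`. If `d ≠ K`, several classes share an orbit and are missed together;
if `d = K`, the classes sit at distance `b / q` from each other and one alone can be missed, which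
accounts for the extra term `b / q`. -/

/-- The indices `j` for which `t + j b` lies in `[m a, m a + c)`. -/
noncomputable def latticeWindow (a b c t : ℝ) (m : ℤ) : Finset ℤ :=
  Finset.Ico ⌈(m * a - t) / b⌉ ⌈(m * a + c - t) / b⌉

theorem mem_latticeWindow {a b c t : ℝ} (hb : 0 < b) {m j : ℤ} :
    j ∈ latticeWindow a b c t m ↔ 0 ≤ t + j * b - m * a ∧ t + j * b - m * a < c := by
  rw [latticeWindow, Finset.mem_Ico, Int.ceil_le, Int.lt_ceil, div_le_iff₀ hb, lt_div_iff₀ hb]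
  constructor <;> rintro ⟨h1, h2⟩ <;> constructor <;> linarith

/-- The sum of `v` over a window of the lattice. -/
noncomputable def windowSum (a b c t : ℝ) (m : ℤ) (v : ℤ → ℂ) : ℂ :=
  ∑ j ∈ latticeWindow a b c t m, v j

/-! ### Periodization -/

/-- The multiples of `b > 0` are indexed by the integers. -/
noncomputable def intEquivZMultiples {b : ℝ} (hb : 0 < b) : ℤ ≃ AddSubgroup.zmultiples b :=
  Equiv.ofInjective (fun n : ℤ => n • b) (zsmul_left_strictMono hb).injective

theorem lintegral_eq_tsum_Ioc {b : ℝ} (hb : 0 < b) (τ : ℝ) (F : ℝ → ENNReal) :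
    ∫⁻ x, F x = ∑' j : ℤ, ∫⁻ t in Set.Ioc τ (τ + b), F (t + j * b) := by
  rw [(isAddFundamentalDomain_Ioc hb τ volume).lintegral_eq_tsum'' F,
    ← (intEquivZMultiples hb).tsum_eq]
  refine tsum_congr fun j => lintegral_congr fun t => ?_
  congr 1
  change j • b + t = _
  simp [add_comm]

theorem integral_eq_tsum_Ioc {b : ℝ} (hb : 0 < b) (τ : ℝ) {F : ℝ → ℂ} (hF : Integrable F) :
    ∫ x, F x = ∑' j : ℤ, ∫ t in Set.Ioc τ (τ + b), F (t + j * b) := by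
  rw [(isAddFundamentalDomain_Ioc hb τ volume).integral_eq_tsum'' F hF,
    ← (intEquivZMultiples hb).tsum_eq]
  refine tsum_congr fun j => integral_congr_ae (Filter.Eventually.of_forall fun t => ?_)
  change F (j • b + t) = _
  simp [add_comm]

/-- Over one period of `t` only finitely many indices matter, so folded sums are finite and commute
with the integral. -/
theorem exists_finset_latticeWindow_subset {b : ℝ} (a c τ : ℝ) (hb : 0 < b) (m : ℤ) :
    ∃ S : Finset ℤ, ∀ t ∈ Set.Ioc τ (τ + b), latticeWindow a b c t m ⊆ S := by
  refine ⟨Finset.Ico ⌈(m * a - (τ + b)) / b⌉ ⌈(m * a + c - τ) / b⌉, fun t ht => ?_⟩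
  refine Finset.Ico_subset_Ico (Int.ceil_mono ?_) (Int.ceil_mono ?_)
  · gcongr; exact ht.2
  · gcongr; exact ht.1.le

/-- The part of `f` seen by the window `[m a, m a + c)`. -/
noncomputable def localized (a c : ℝ) (m : ℤ) (f : ℝ → ℂ) : ℝ → ℂ :=
  (Set.Ico (m * a : ℝ) (m * a + c)).indicator f

theorem sum_localized {a b c t : ℝ} (hb : 0 < b) {m : ℤ} {S : Finset ℤ}
    (hS : latticeWindow a b c t m ⊆ S) (f : ℝ → ℂ) :
    ∑ j ∈ S, localized a c m f (t + j * b) =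
      windowSum a b c t m fun j => f (t + j * b) := by
  classical
  rw [windowSum, ← Finset.sum_subset hS]
  · refine Finset.sum_congr rfl fun j hj => ?_
    rw [mem_latticeWindow hb] at hj
    rw [localized, Set.indicator_of_mem]
    exact ⟨by linarith [hj.1], by linarith [hj.2]⟩
  · intro j _ hj
    rw [mem_latticeWindow hb] at hj
    refine Set.indicator_of_notMem (fun h => hj ?_) _
    exact ⟨by linarith [h.1], by linarith [h.2]⟩

theorem memLp_localized {f : ℝ → ℂ} (hf : MemLp f 2) (a c : ℝ) (m : ℤ) :
    MemLp (localized a c m f) 2 := hf.indicator measurableSet_Ico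

theorem memLp_comp_add {f : ℝ → ℂ} (hf : MemLp f 2) (s : ℝ) :
    MemLp (fun t => f (t + s)) 2 :=
  hf.comp_measurePreserving (measurePreserving_add_right volume s)

theorem memLp_windowSum {f : ℝ → ℂ} (hf : MemLp f 2) (a c τ : ℝ) {b : ℝ} (hb : 0 < b) (m : ℤ) :
    MemLp (fun t => windowSum a b c t m fun j => f (t + j * b)) 2
      (volume.restrict (Set.Ioc τ (τ + b))) := by
  obtain ⟨S, hS⟩ := exists_finset_latticeWindow_subset a c τ hb m
  have h : MemLp (fun t => ∑ j ∈ S, localized a c m f (t + j * b)) 2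
      (volume.restrict (Set.Ioc τ (τ + b))) :=
    memLp_finsetSum _ fun j _ => (memLp_comp_add (memLp_localized hf a c m) _).restrict _
  refine h.ae_eq ?_
  filter_upwards [ae_restrict_mem measurableSet_Ioc] with t ht
  exact sum_localized hb (hS t ht) f

theorem integrable_localized {f : ℝ → ℂ} (hf : MemLp f 2) (a c : ℝ) (m : ℤ) :
    Integrable (localized a c m f) := by
  rw [localized, integrable_indicator_iff measurableSet_Ico]
  exact (hf.restrict _).integrable one_le_two

/-- The exponential `exp (2 π i n x / b)`. -/
noncomputable def expChar (b : ℝ) (n : ℤ) (x : ℝ) : ℂ := Complex.exp (2 * Real.pi * Complex.I * n * x / b)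

theorem expChar_add_int_mul {b : ℝ} (hb : 0 < b) (n j : ℤ) (x : ℝ) :
    expChar b n (x + j * b) = expChar b n x := by
  rw [expChar, expChar, Complex.exp_eq_exp_iff_exists_int]
  refine ⟨n * j, ?_⟩
  have : (b : ℂ) ≠ 0 := by exact_mod_cast hb.ne'
  push_cast
  field_simp

theorem norm_expChar (b : ℝ) (n : ℤ) (x : ℝ) : ‖expChar b n x‖ = 1 := by
  have h2 : (2 * Real.pi * Complex.I * n * x / b : ℂ)
      = ((2 * Real.pi * n * x / b : ℝ) : ℂ) * Complex.I := by
    push_cast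
    ring
  rw [expChar, h2, Complex.norm_exp_ofReal_mul_I]

theorem continuous_expChar (b : ℝ) (n : ℤ) : Continuous (expChar b n) := by
  unfold expChar; fun_prop

theorem integrable_expChar_mul {F : ℝ → ℂ} {μ : Measure ℝ} (hF : Integrable F μ) (b : ℝ) (n : ℤ) :
    Integrable (fun x => expChar b n x * F x) μ := by
  refine hF.bdd_mul (c := 1) (continuous_expChar b n).aestronglyMeasurable ?_
  exact Filter.Eventually.of_forall fun x => (norm_expChar b n x).le

/-- The exponential is `b`-periodic, so it factors out of the folded sum and leaves a Fourier
integral over one period. -/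
theorem integral_expChar_mul_localized {f : ℝ → ℂ} (hf : MemLp f 2) (a c τ : ℝ) {b : ℝ}
    (hb : 0 < b) (m n : ℤ) :
    ∫ x, expChar b n x * localized a c m f x =
      ∫ t in Set.Ioc τ (τ + b), expChar b n t * windowSum a b c t m fun j => f (t + j * b) := by
  obtain ⟨S, hS⟩ := exists_finset_latticeWindow_subset a c τ hb m
  rw [integral_eq_tsum_Ioc hb τ (integrable_expChar_mul (integrable_localized hf a c m) b n),
    tsum_eq_sum (s := S), ← integral_finsetSum]
  · refine setIntegral_congr_fun measurableSet_Ioc fun t ht => ?_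
    simp only [expChar_add_int_mul hb, ← Finset.mul_sum]
    rw [sum_localized hb (hS t ht) f]
  · intro j _
    exact ((integrable_expChar_mul (integrable_localized hf a c m) b n).comp_add_right _).restrict
  · intro j hj
    refine setIntegral_eq_zero_of_forall_eq_zero fun t ht => ?_
    rw [localized, Set.indicator_of_notMem, mul_zero]
    intro h
    exact hj (hS t ht ((mem_latticeWindow hb).2 ⟨by linarith [h.1], by linarith [h.2]⟩))

theorem inner_gaborSystem_idealWindow (a b c : ℝ) (f : Lp ℂ 2 (volume : Measure ℝ)) (m n : ℤ) :
    inner ℂ (gaborSystem (idealWindow c) a b (m, n)) f =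
      ∫ x, expChar b n x * localized a c m f x := by
  rw [L2.inner_def]
  refine integral_congr_ae ?_
  have h1 : gaborSystem (idealWindow c) a b (m, n) =ᵐ[volume]
      timeFreqShift (idealWindow c) a b m n := MemLp.coeFn_toLp _
  have h2 : (fun t : ℝ => (idealWindow c : ℝ → ℂ) (t - m * a)) =ᵐ[volume]
      fun t => (Set.Ico 0 c).indicator (fun _ => (1 : ℂ)) (t - m * a) :=
    (measurePreserving_sub_right volume (m * a : ℝ)).quasiMeasurePreserving.ae_eq_comp
      indicatorConstLp_coeFn
  filter_upwards [h1, h2] with t ht1 ht2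
  rw [ht1, RCLike.inner_apply, timeFreqShift, ht2, map_mul, ← Complex.exp_conj]
  have h3 : (starRingEnd ℂ) (-2 * Real.pi * Complex.I * n * t / b) =
      2 * Real.pi * Complex.I * n * t / b := by
    simp [Complex.conj_ofNat]
  rw [h3, localized, expChar]
  by_cases h : t ∈ Set.Ico (m * a : ℝ) (m * a + c)
  · rw [Set.indicator_of_mem h, Set.indicator_of_mem]
    · simp [mul_comm]
    · exact ⟨by linarith [h.1], by linarith [h.2]⟩
  · rw [Set.indicator_of_notMem h, Set.indicator_of_notMem]
    · simp
    · exact fun h' => h ⟨by linarith [h'.1], by linarith [h'.2]⟩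

theorem hasSum_sq_integral_expChar_mul {b : ℝ} (hb : 0 < b) (τ : ℝ) {G : ℝ → ℂ}
    (hG : MemLp G 2 (volume.restrict (Set.Ioc τ (τ + b)))) :
    HasSum (fun n : ℤ => ‖∫ t in Set.Ioc τ (τ + b), expChar b n t * G t‖ ^ 2)
      (b * ∫ t in Set.Ioc τ (τ + b), ‖G t‖ ^ 2) := by
  have hlt : τ < τ + b := by linarith
  have h := (hasSum_sq_fourierCoeffOn hlt hG).mul_left (b ^ 2)
  -- Fourier coefficients carry the opposite sign in the exponent, hence the reindexing `n ↦ -n`.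
  rw [← (Equiv.neg ℤ).hasSum_iff] at h
  have e1 : (fun n : ℤ => ‖∫ t in Set.Ioc τ (τ + b), expChar b n t * G t‖ ^ 2) =
      (fun i => b ^ 2 * ‖fourierCoeffOn hlt G i‖ ^ 2) ∘ Equiv.neg ℤ := by
    ext n
    simp only [Function.comp, Equiv.neg_apply, fourierCoeffOn_eq_integral, neg_neg]
    rw [intervalIntegral.integral_of_le hlt.le, norm_smul, mul_pow, ← mul_assoc]
    have : (b ^ 2 * ‖1 / (τ + b - τ)‖ ^ 2) = 1 := by
      rw [add_sub_cancel_left, Real.norm_of_nonneg (by positivity)]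
      field_simp
    rw [this, one_mul]
    congr 2
    refine setIntegral_congr_fun measurableSet_Ioc fun t _ => ?_
    simp only [smul_eq_mul, fourier_coe_apply, expChar, add_sub_cancel_left]
  have e2 : b * ∫ t in Set.Ioc τ (τ + b), ‖G t‖ ^ 2 =
      b ^ 2 * (τ + b - τ)⁻¹ • ∫ t in τ..(τ + b), ‖G t‖ ^ 2 := by
    rw [intervalIntegral.integral_of_le hlt.le, add_sub_cancel_left, smul_eq_mul]
    field_simp
  rw [e1, e2]
  exact h

theorem ofReal_integral_norm_sq {μ : Measure ℝ} {G : ℝ → ℂ} (hG : MemLp G 2 μ) :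
    ENNReal.ofReal (∫ t, ‖G t‖ ^ 2 ∂μ) = ∫⁻ t, ‖G t‖ₑ ^ 2 ∂μ := by
  rw [ofReal_integral_eq_lintegral_ofReal (hG.integrable_norm_pow two_ne_zero)
    (Filter.Eventually.of_forall fun t => by positivity)]
  refine lintegral_congr fun t => ?_
  rw [ENNReal.ofReal_pow (norm_nonneg _), ofReal_norm]

/-- The frame sum of `f`, in terms of the fibers `j ↦ f (t + j b)`. -/
theorem tsum_inner_gaborSystem_sq {b : ℝ} (hb : 0 < b) (a c τ : ℝ)
    (f : Lp ℂ 2 (volume : Measure ℝ)) :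
    ∑' mn, ENNReal.ofReal (‖inner ℂ (gaborSystem (idealWindow c) a b mn) f‖ ^ 2) =
      ENNReal.ofReal b * ∫⁻ t in Set.Ioc τ (τ + b),
        ∑' m, ‖windowSum a b c t m fun j => f (t + j * b)‖ₑ ^ 2 := by
  have hf := Lp.memLp f
  rw [ENNReal.tsum_prod', lintegral_tsum, ← ENNReal.tsum_mul_left]
  · refine tsum_congr fun m => ?_
    have hG := memLp_windowSum hf a c τ hb m
    have h := hasSum_sq_integral_expChar_mul hb τ hG
    simp only [inner_gaborSystem_idealWindow, integral_expChar_mul_localized hf a c τ hb]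
    rw [← ENNReal.ofReal_tsum_of_nonneg (fun n => by positivity) h.summable, h.tsum_eq,
      ENNReal.ofReal_mul hb.le, ofReal_integral_norm_sq hG]
  · intro m
    exact (memLp_windowSum hf a c τ hb m).1.enorm.pow_const 2

theorem ofReal_norm_sq_eq_lintegral {b : ℝ} (hb : 0 < b) (τ : ℝ)
    (f : Lp ℂ 2 (volume : Measure ℝ)) :
    ENNReal.ofReal (‖f‖ ^ 2) =
      ∫⁻ t in Set.Ioc τ (τ + b), ∑' j : ℤ, ‖f (t + j * b)‖ₑ ^ 2 := by
  have hf := Lp.memLp f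
  have h1 : ‖f‖ ^ 2 = ∫ x, ‖f x‖ ^ 2 := by
    rw [← inner_self_eq_norm_sq (𝕜 := ℂ), L2.inner_def, ← integral_re]
    · refine integral_congr_ae (Filter.Eventually.of_forall fun x => ?_)
      exact inner_self_eq_norm_sq (𝕜 := ℂ) _
    · exact L2.integrable_inner f f
  rw [h1, ofReal_integral_norm_sq hf, lintegral_eq_tsum_Ioc hb τ, lintegral_tsum]
  intro j
  exact (memLp_comp_add hf _).1.enorm.pow_const 2 |>.restrict

/-! ### The Bessel bound on fibers -/

theorem ENNReal.sq_sum_le_card_mul_sum_sq {ι : Type*} (s : Finset ι) (f : ι → ENNReal) :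
    (∑ i ∈ s, f i) ^ 2 ≤ s.card * ∑ i ∈ s, f i ^ 2 := by
  by_cases h : ∀ i ∈ s, f i ≠ ⊤
  · have h1 : ∀ i ∈ s, f i = ((f i).toNNReal : ENNReal) := fun i hi =>
      (ENNReal.coe_toNNReal (h i hi)).symm
    have h2 : ∀ i ∈ s, f i ^ 2 = ((f i).toNNReal : ENNReal) ^ 2 := fun i hi => by rw [← h1 i hi]
    rw [Finset.sum_congr rfl h1, Finset.sum_congr rfl h2]
    have h3 : (∑ i ∈ s, (f i).toNNReal) ^ 2 ≤ s.card * ∑ i ∈ s, (f i).toNNReal ^ 2 :=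
      _root_.sq_sum_le_card_mul_sum_sq
    exact_mod_cast h3
  · push Not at h
    obtain ⟨i, hi, hfi⟩ := h
    have h1 : ∑ i ∈ s, f i ^ 2 = ⊤ := ENNReal.sum_eq_top.2 ⟨i, hi, by simp [hfi]⟩
    have h2 : (s.card : ENNReal) ≠ 0 := by
      exact_mod_cast (Finset.card_pos.2 ⟨i, hi⟩).ne'
    rw [h1, ENNReal.mul_top h2]
    exact le_top

theorem card_latticeWindow_le (a b c t : ℝ) (m : ℤ) :
    (latticeWindow a b c t m).card ≤ ⌈c / b⌉₊ := by
  rw [latticeWindow, Int.card_Ico, Int.toNat_le]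
  have h1 : (m * a + c - t) / b = (m * a - t) / b + c / b := by ring
  have h2 := Int.ceil_add_le ((m * a - t) / b) (c / b)
  have h3 : ⌈c / b⌉ ≤ (⌈c / b⌉₊ : ℤ) := Int.ceil_le.2 (by exact_mod_cast Nat.le_ceil _)
  rw [h1]
  linarith

theorem tsum_indicator_latticeWindow_le {a b : ℝ} (ha : 0 < a) (hb : 0 < b) (c t : ℝ) (j : ℤ)
    (x : ENNReal) :
    ∑' m, (if j ∈ latticeWindow a b c t m then x else 0) ≤ (⌈c / a⌉₊ + 1 : ℕ) * x := by
  set S : Finset ℤ := Finset.Ioc ⌊(t + j * b - c) / a⌋ ⌊(t + j * b) / a⌋ with hS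
  have hmem : ∀ m, j ∈ latticeWindow a b c t m → m ∈ S := by
    intro m hm
    rw [mem_latticeWindow hb] at hm
    rw [hS, Finset.mem_Ioc, Int.floor_lt, Int.le_floor, div_lt_iff₀ ha, le_div_iff₀ ha]
    exact ⟨by linarith [hm.2], by linarith [hm.1]⟩
  have hcard : S.card ≤ ⌈c / a⌉₊ + 1 := by
    rw [hS, Int.card_Ioc, Int.toNat_le]
    have h3 : (c / a : ℝ) ≤ ⌈c / a⌉₊ := Nat.le_ceil _
    have h4 := Int.floor_le ((t + j * b) / a)
    have h5 := Int.lt_floor_add_one ((t + j * b - c) / a)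
    have h6 : (t + j * b - c) / a = (t + j * b) / a - c / a := by ring
    have h7 : (⌊(t + j * b) / a⌋ : ℝ) < ⌊(t + j * b - c) / a⌋ + 1 + ⌈c / a⌉₊ := by linarith
    have h8 : ⌊(t + j * b) / a⌋ < ⌊(t + j * b - c) / a⌋ + 1 + ⌈c / a⌉₊ := by exact_mod_cast h7
    push_cast
    linarith
  rw [tsum_eq_sum (s := S) fun m hm => if_neg fun h => hm (hmem m h)]
  calc _ ≤ ∑ m ∈ S, x := Finset.sum_le_sum fun m _ => by split_ifs <;> simp
    _ = S.card * x := by simp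
    _ ≤ _ := by gcongr

/-- Cauchy–Schwarz on windows of at most `⌈c / b⌉₊` entries, each index lying in at most `⌈c / a⌉₊ +
1` windows. -/
theorem tsum_windowSum_sq_le {a b : ℝ} (ha : 0 < a) (hb : 0 < b) (c t : ℝ) (v : ℤ → ℂ) :
    ∑' m, ‖windowSum a b c t m v‖ₑ ^ 2 ≤
      (⌈c / b⌉₊ * (⌈c / a⌉₊ + 1) : ℕ) * ∑' j, ‖v j‖ₑ ^ 2 := by
  have h1 : ∀ m, ‖windowSum a b c t m v‖ₑ ^ 2 ≤
      ⌈c / b⌉₊ * ∑' j, if j ∈ latticeWindow a b c t m then ‖v j‖ₑ ^ 2 else 0 := by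
    intro m
    calc ‖windowSum a b c t m v‖ₑ ^ 2 ≤ (∑ j ∈ latticeWindow a b c t m, ‖v j‖ₑ) ^ 2 := by
          gcongr
          exact enorm_sum_le _ _
      _ ≤ (latticeWindow a b c t m).card * ∑ j ∈ latticeWindow a b c t m, ‖v j‖ₑ ^ 2 :=
          ENNReal.sq_sum_le_card_mul_sum_sq _ _
      _ ≤ ⌈c / b⌉₊ * ∑ j ∈ latticeWindow a b c t m, ‖v j‖ₑ ^ 2 := by
          gcongr
          exact card_latticeWindow_le a b c t m
      _ = _ := by
          congr 1
          rw [tsum_eq_sum (s := latticeWindow a b c t m) fun j hj => if_neg hj]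
          exact Finset.sum_congr rfl fun j hj => (if_pos hj).symm
  calc _ ≤ ∑' m, ⌈c / b⌉₊ * ∑' j, (if j ∈ latticeWindow a b c t m then ‖v j‖ₑ ^ 2 else 0) :=
        ENNReal.tsum_le_tsum h1
    _ = ⌈c / b⌉₊ * ∑' j, ∑' m, (if j ∈ latticeWindow a b c t m then ‖v j‖ₑ ^ 2 else 0) := by
        rw [ENNReal.tsum_mul_left, ENNReal.tsum_comm]
    _ ≤ ⌈c / b⌉₊ * ∑' j, (⌈c / a⌉₊ + 1 : ℕ) * ‖v j‖ₑ ^ 2 := by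
        gcongr with j
        exact tsum_indicator_latticeWindow_le ha hb c t j _
    _ = _ := by
        rw [ENNReal.tsum_mul_left, Nat.cast_mul, mul_assoc]

/-! ### Frames and fibers -/

/-- Uniform stability of all fibers implies the frame property. -/
theorem isGaborFrame_of_fiber_bound {a b c : ℝ} (ha : 0 < a) (hb : 0 < b) (hc : 0 < c) {C : ℕ}
    (h : ∀ (t : ℝ) (v : ℤ → ℂ),
      ∑' j, ‖v j‖ₑ ^ 2 ≤ C * ∑' m, ‖windowSum a b c t m v‖ₑ ^ 2) :
    IsGaborFrame (idealWindow c) a b := by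
  set B : ℕ := ⌈c / b⌉₊ * (⌈c / a⌉₊ + 1) with hB
  have hBpos : 0 < B := Nat.mul_pos (Nat.ceil_pos.2 (by positivity)) (Nat.succ_pos _)
  -- The `+ 1` keeps the lower bound meaningful when `C = 0`.
  refine ⟨b / (C + 1), b * B, by positivity, by positivity, fun f => ?_⟩
  have hX := tsum_inner_gaborSystem_sq hb a c 0 f
  have hY := ofReal_norm_sq_eq_lintegral hb 0 f
  set X := ∫⁻ t in Set.Ioc 0 (0 + b), ∑' m, ‖windowSum a b c t m fun j => f (t + j * b)‖ₑ ^ 2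
  have hXY : X ≤ B * ENNReal.ofReal (‖f‖ ^ 2) := by
    rw [hY, ← lintegral_const_mul' _ _ (ENNReal.natCast_ne_top B)]
    exact lintegral_mono fun t => tsum_windowSum_sq_le ha hb c t _
  have hYX : ENNReal.ofReal (‖f‖ ^ 2) ≤ C * X := by
    rw [hY, ← lintegral_const_mul' _ _ (ENNReal.natCast_ne_top C)]
    exact lintegral_mono fun t => h t _
  have hsum : Summable fun i => ‖inner ℂ (gaborSystem (idealWindow c) a b i) f‖ ^ 2 := by
    have h1 : ∑' mn, ENNReal.ofReal (‖inner ℂ (gaborSystem (idealWindow c) a b mn) f‖ ^ 2) ≠ ⊤ := by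
      rw [hX]
      refine ENNReal.mul_ne_top ENNReal.ofReal_ne_top (ne_top_of_le_ne_top ?_ hXY)
      exact ENNReal.mul_ne_top (ENNReal.natCast_ne_top B) ENNReal.ofReal_ne_top
    refine (ENNReal.summable_toReal h1).congr fun i => ?_
    exact ENNReal.toReal_ofReal (by positivity)
  rw [← ENNReal.ofReal_tsum_of_nonneg (fun i => by positivity) hsum] at hX
  set s := ∑' i, ‖inner ℂ (gaborSystem (idealWindow c) a b i) f‖ ^ 2
  have hs : 0 ≤ s := tsum_nonneg fun i => by positivity
  refine ⟨hsum, ?_, ?_⟩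
  · have h2 : ENNReal.ofReal (b * ‖f‖ ^ 2) ≤ ENNReal.ofReal (C * s) := by
      rw [ENNReal.ofReal_mul hb.le, ENNReal.ofReal_mul (by positivity), hX, ENNReal.ofReal_natCast]
      calc _ ≤ ENNReal.ofReal b * (C * X) := by gcongr
        _ = _ := by ring
    rw [ENNReal.ofReal_le_ofReal_iff (by positivity)] at h2
    rw [div_mul_eq_mul_div, div_le_iff₀ (by positivity)]
    linarith
  · have h2 : ENNReal.ofReal s ≤ ENNReal.ofReal (b * B * ‖f‖ ^ 2) := by
      rw [hX, mul_assoc, ENNReal.ofReal_mul hb.le, ENNReal.ofReal_mul (by positivity),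
        ENNReal.ofReal_natCast]
      gcongr
    rwa [ENNReal.ofReal_le_ofReal_iff (by positivity)] at h2

/-- The step function equal to `v j` on `E + j b`. -/
noncomputable def stepFunction (b : ℝ) (E : Set ℝ) (S : Finset ℤ) (v : ℤ → ℂ) (x : ℝ) : ℂ :=
  ∑ j ∈ S, E.indicator (fun _ => v j) (x - j * b)

theorem memLp_stepFunction {E : Set ℝ} (hE : MeasurableSet E) (hE' : volume E ≠ ⊤) (b : ℝ)
    (S : Finset ℤ) (v : ℤ → ℂ) : MemLp (stepFunction b E S v) 2 := by
  refine memLp_finsetSum _ fun j _ => ?_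
  exact (memLp_indicator_const 2 hE (v j) (Or.inr hE')).comp_measurePreserving
    (measurePreserving_sub_right volume (j * b : ℝ))

theorem eq_of_add_mul_mem_Ioc {b τ t : ℝ} (hb : 0 < b) {i j : ℤ} (h1 : t ∈ Set.Ioc τ (τ + b))
    (h2 : t + i * b - j * b ∈ Set.Ioc τ (τ + b)) : i = j := by
  have h3 : ((i - j : ℤ) : ℝ) * b < 1 * b := by push_cast; linarith [h1.1, h2.2]
  have h4 : ((j - i : ℤ) : ℝ) * b < 1 * b := by push_cast; linarith [h1.2, h2.1]
  have h5 : i - j < 1 := by exact_mod_cast lt_of_mul_lt_mul_right h3 hb.le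
  have h6 : j - i < 1 := by exact_mod_cast lt_of_mul_lt_mul_right h4 hb.le
  omega

theorem stepFunction_apply {b τ t : ℝ} (hb : 0 < b) {E : Set ℝ} (hE : E ⊆ Set.Ioc τ (τ + b))
    {S : Finset ℤ} {v : ℤ → ℂ} (hv : ∀ j ∉ S, v j = 0) (ht : t ∈ Set.Ioc τ (τ + b)) (i : ℤ) :
    stepFunction b E S v (t + i * b) = E.indicator (fun _ => v i) t := by
  have h0 : ∀ j, j ≠ i → E.indicator (fun _ => v j) (t + i * b - j * b) = 0 := fun j hj =>
    Set.indicator_of_notMem (fun h => hj (eq_of_add_mul_mem_Ioc hb ht (hE h)).symm) _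
  rw [stepFunction, Finset.sum_eq_single i fun j _ hj => h0 j hj, add_sub_cancel_right]
  intro hi
  rw [hv i hi]
  simp

/-- For a frame, the fibers over a set of positive measure are stable on finitely supported
sequences. -/
theorem IsGaborFrame.fiber_bound {a b c τ : ℝ} (hb : 0 < b)
    (h : IsGaborFrame (idealWindow c) a b) {E : Set ℝ} (hE : MeasurableSet E)
    (hEτ : E ⊆ Set.Ioc τ (τ + b)) (hE0 : volume E ≠ 0) :
    ∃ A : ENNReal, A ≠ 0 ∧ ∀ (S : Finset ℤ) (v : ℤ → ℂ) (M : ENNReal), (∀ j ∉ S, v j = 0) →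
      (∀ t ∈ E, ∑' m, ‖windowSum a b c t m v‖ₑ ^ 2 ≤ M) →
        A * ∑' j, ‖v j‖ₑ ^ 2 ≤ ENNReal.ofReal b * M := by
  obtain ⟨A, _, hA, -, hAB⟩ := h
  refine ⟨ENNReal.ofReal A, by simpa using hA, fun S v M hv hM => ?_⟩
  have hEtop : volume E ≠ ⊤ := measure_ne_top_of_subset hEτ measure_Ioc_lt_top.ne
  have hF := memLp_stepFunction hE hEtop b S v
  set f : Lp ℂ 2 (volume : Measure ℝ) := hF.toLp _
  have hfF : ∀ᵐ t ∂volume.restrict (Set.Ioc τ (τ + b)), ∀ j : ℤ,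
      f (t + j * b) = E.indicator (fun _ => v j) t := by
    have h1 : ∀ᵐ t : ℝ, ∀ j : ℤ, f (t + j * b) = stepFunction b E S v (t + j * b) :=
      ae_all_iff.2 fun j => (measurePreserving_add_right volume (j * b : ℝ)).quasiMeasurePreserving
        |>.ae_eq_comp hF.coeFn_toLp
    filter_upwards [ae_restrict_of_ae h1, ae_restrict_mem measurableSet_Ioc] with t h2 ht j
    rw [h2, stepFunction_apply hb hEτ hv ht]
  obtain ⟨hsum, hlow, -⟩ := hAB f
  have hX := tsum_inner_gaborSystem_sq hb a c τ f
  have hY := ofReal_norm_sq_eq_lintegral hb τ f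
  rw [← ENNReal.ofReal_tsum_of_nonneg (fun i => by positivity) hsum] at hX
  have h1 := ENNReal.ofReal_le_ofReal hlow
  rw [hX, ENNReal.ofReal_mul hA.le, hY] at h1
  have hY' : ∫⁻ t in Set.Ioc τ (τ + b), ∑' j : ℤ, ‖f (t + j * b)‖ₑ ^ 2 =
      (∑' j, ‖v j‖ₑ ^ 2) * volume E := by
    rw [← lintegral_indicator_const hE, ← lintegral_indicator measurableSet_Ioc,
      ← Set.indicator_eq_self.2 ((Set.support_indicator_subset (s := E)
        (f := fun _ => ∑' j, ‖v j‖ₑ ^ 2)).trans hEτ),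
      lintegral_indicator measurableSet_Ioc, lintegral_indicator measurableSet_Ioc]
    refine lintegral_congr_ae ?_
    filter_upwards [hfF] with t ht
    by_cases htE : t ∈ E <;> simp [ht, htE]
  have hX' : ∫⁻ t in Set.Ioc τ (τ + b), ∑' m, ‖windowSum a b c t m fun j => f (t + j * b)‖ₑ ^ 2 ≤
      M * volume E := by
    rw [← lintegral_indicator_const hE]
    refine le_trans (lintegral_mono_ae ?_) (setLIntegral_le_lintegral _ _)
    filter_upwards [hfF] with t ht
    by_cases htE : t ∈ E
    · simpa [ht, htE] using hM t htE
    · simp [ht, htE, windowSum]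
  rw [hY'] at h1
  have h2 := h1.trans (mul_le_mul_right hX' (ENNReal.ofReal b))
  rw [← mul_assoc, ← mul_assoc] at h2
  -- Both sides carry the factor `volume E`, which is neither `0` nor `⊤` and cancels.
  exact (ENNReal.mul_le_mul_iff_left hE0 hEtop).1 h2

/-! ### Block sums -/

/-- The sum of `K` consecutive terms of `v`, starting at `j`. -/
noncomputable def blockSum (K : ℕ) (v : ℤ → ℂ) (j : ℤ) : ℂ := ∑ i ∈ Finset.range K, v (j + i)

theorem blockSum_succ (K : ℕ) (v : ℤ → ℂ) (j : ℤ) :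
    blockSum (K + 1) v j = blockSum K v j + v (j + K) := Finset.sum_range_succ _ _

theorem blockSum_succ' (K : ℕ) (v : ℤ → ℂ) (j : ℤ) :
    blockSum (K + 1) v j = v j + blockSum K v (j + 1) := by
  rw [blockSum, Finset.sum_range_succ', add_comm, blockSum]
  simp [add_comm, add_left_comm]

/-- Sliding a block by one index drops `v j` and gains `v (j + K)`: block sums control `v` along
steps of length `K`. -/
theorem sub_eq_blockSum_sub (K : ℕ) (v : ℤ → ℂ) (j : ℤ) :
    v (j + K) - v j = blockSum K v (j + 1) - blockSum K v j := by
  have h1 := blockSum_succ K v j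
  have h2 := blockSum_succ' K v j
  linear_combination h1.symm.trans h2

theorem sum_Ico_int_eq_blockSum (K : ℕ) (v : ℤ → ℂ) (j : ℤ) :
    ∑ i ∈ Finset.Ico j (j + K), v i = blockSum K v j := by
  rw [blockSum, eq_comm]
  refine Finset.sum_bij (fun i _ => j + i) ?_ ?_ ?_ fun _ _ => rfl
  · intro i hi
    simp only [Finset.mem_range] at hi
    simp only [Finset.mem_Ico]
    omega
  · intro i _ i' _ h
    omega
  · intro x hx
    rw [Finset.mem_Ico] at hx
    exact ⟨(x - j).toNat, by simp only [Finset.mem_range]; omega, by omega⟩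

theorem latticeWindow_eq_Ico {a b c t : ℝ} (hb : 0 < b) {m j : ℤ} {K : ℕ}
    (h0 : 0 ≤ t + j * b - m * a) (h1 : t + j * b - m * a < b)
    (h2 : c ≤ t + j * b - m * a + K * b) (h3 : t + j * b - m * a + K * b - b < c) :
    latticeWindow a b c t m = Finset.Ico j (j + K) := by
  have key : ∀ x : ℤ, 0 ≤ t + j * b - m * a + x * b ↔ 0 ≤ x := by
    intro x
    constructor
    · intro h
      by_contra hx
      have : (x : ℝ) ≤ -1 := by exact_mod_cast (by omega : x ≤ -1)
      nlinarith
    · intro h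
      have : (0 : ℝ) ≤ x := by exact_mod_cast h
      positivity
  ext i
  rw [mem_latticeWindow hb, Finset.mem_Ico]
  have e : t + i * b - m * a = t + j * b - m * a + ((i - j : ℤ) : ℝ) * b := by push_cast; ring
  rw [e, key]
  constructor
  · rintro ⟨h4, h5⟩
    refine ⟨by omega, ?_⟩
    by_contra h6
    have : (K : ℝ) ≤ ((i - j : ℤ) : ℝ) := by exact_mod_cast (by omega : (K : ℤ) ≤ i - j)
    nlinarith
  · rintro ⟨h4, h5⟩
    refine ⟨by omega, ?_⟩
    have : ((i - j : ℤ) : ℝ) ≤ K - 1 := by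
      have : i - j ≤ (K : ℤ) - 1 := by omega
      exact_mod_cast this
    nlinarith

/-- The block of `K` indices starting at `j` is one of the windows. -/
def IsWindow (a b c t : ℝ) (K : ℕ) (j : ℤ) : Prop :=
  ∃ m : ℤ, 0 ≤ t + j * b - m * a ∧ t + j * b - m * a < b ∧
    c ≤ t + j * b - m * a + K * b ∧ t + j * b - m * a + K * b - b < c

/-- The offset in `[0, b)` makes `m` determine the first index of its window, so distinct blocks use
distinct windows. -/
theorem tsum_blockSum_sq_le {a b c t : ℝ} (hb : 0 < b) {K : ℕ} {J : Set ℤ}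
    (hJ : ∀ j ∈ J, IsWindow a b c t K j) (v : ℤ → ℂ) :
    ∑' j : J, ‖blockSum K v j‖ₑ ^ 2 ≤ ∑' m, ‖windowSum a b c t m v‖ₑ ^ 2 := by
  choose m h0 h1 h2 h3 using fun j : J => hJ j j.2
  have hinj : Function.Injective m := by
    intro i j hij
    have h4 := h0 i; have h5 := h1 i; have h6 := h0 j; have h7 := h1 j
    rw [hij] at h4 h5
    -- The sign change turns `[0, b)` into the interval `(-b, 0]` that the lemma requires.
    refine Subtype.ext (eq_of_add_mul_mem_Ioc (τ := -b) (t := -(t + j * b - m j * a)) hb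
      ⟨by linarith, by linarith⟩ ⟨by linarith, by linarith⟩).symm
  refine le_trans (le_of_eq (tsum_congr fun j => ?_))
    (ENNReal.tsum_comp_le_tsum_of_injective hinj fun m => ‖windowSum a b c t m v‖ₑ ^ 2)
  rw [windowSum, latticeWindow_eq_Ico hb (h0 j) (h1 j) (h2 j) (h3 j), sum_Ico_int_eq_blockSum]

theorem ENNReal.add_sq_le_two_mul (x y : ENNReal) : (x + y) ^ 2 ≤ 2 * (x ^ 2 + y ^ 2) := by
  have h := ENNReal.sq_sum_le_card_mul_sum_sq Finset.univ ![x, y]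
  simpa [Fin.sum_univ_two] using h

theorem enorm_sub_sq_le (x y : ℂ) : ‖x - y‖ₑ ^ 2 ≤ 2 * (‖x‖ₑ ^ 2 + ‖y‖ₑ ^ 2) :=
  (pow_le_pow_left' enorm_sub_le 2).trans (ENNReal.add_sq_le_two_mul _ _)

/-- The entry `v j` is the block of `k + 1` indices from `j - k` minus the block of `k` from the
same index. -/
theorem tsum_entry_sq_le {a b c t : ℝ} (hb : 0 < b) {k : ℕ} {J : Set ℤ}
    (hJ : ∀ j ∈ J, IsWindow a b c t k (j - k) ∧ IsWindow a b c t (k + 1) (j - k)) (v : ℤ → ℂ) :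
    ∑' j : J, ‖v j‖ₑ ^ 2 ≤ 4 * ∑' m, ‖windowSum a b c t m v‖ₑ ^ 2 := by
  set J' : Set ℤ := {i | i + k ∈ J} with hJ'
  have hJ1 : ∀ i ∈ J', IsWindow a b c t k i ∧ IsWindow a b c t (k + 1) i := by
    intro i hi
    simpa using hJ (i + k) hi
  let e : J' ≃ J :=
    { toFun := fun i => ⟨i + k, i.2⟩
      invFun := fun j => ⟨j - k, by simp [hJ']⟩
      left_inv := fun i => by simp
      right_inv := fun j => by simp }
  rw [← e.tsum_eq]
  have h1 : ∀ i : J', ‖v (e i)‖ₑ ^ 2 ≤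
      2 * (‖blockSum (k + 1) v i‖ₑ ^ 2 + ‖blockSum k v i‖ₑ ^ 2) := by
    intro i
    have : v (e i) = blockSum (k + 1) v i - blockSum k v i := by
      rw [blockSum_succ, add_sub_cancel_left]
      rfl
    rw [this]
    exact enorm_sub_sq_le _ _
  refine (ENNReal.tsum_le_tsum h1).trans ?_
  rw [ENNReal.tsum_mul_left, ENNReal.tsum_add]
  calc _ ≤ 2 * (∑' m, ‖windowSum a b c t m v‖ₑ ^ 2 + ∑' m, ‖windowSum a b c t m v‖ₑ ^ 2) := by
        gcongr
        · exact tsum_blockSum_sq_le hb (fun i hi => (hJ1 i hi).2) v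
        · exact tsum_blockSum_sq_le hb (fun i hi => (hJ1 i hi).1) v
    _ = _ := by ring

/-! ### Recovering a sequence from its block sums and some of its entries -/

theorem enorm_sub_le_sum_blockSum (K : ℕ) (v : ℤ → ℂ) (x : ℤ) (n : ℕ) :
    ‖v (x + n * K) - v x‖ₑ ≤
      ∑ i ∈ Finset.range n, (‖blockSum K v (x + i * K + 1)‖ₑ + ‖blockSum K v (x + i * K)‖ₑ) := by
  induction n with
  | zero => simp
  | succ n ih =>
    rw [Finset.sum_range_succ]
    have h : v (x + (n + 1 : ℕ) * K) - v x = (v (x + n * K) - v x) +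
        (blockSum K v (x + n * K + 1) - blockSum K v (x + n * K)) := by
      rw [← sub_eq_blockSum_sub]
      have : x + ((n + 1 : ℕ) : ℤ) * K = x + n * K + K := by push_cast; ring
      rw [this]
      ring
    rw [h]
    exact (enorm_add_le _ _).trans (add_le_add ih enorm_sub_le)

/-- The sum of `G` over the interval of radius `U` around `j`. -/
noncomputable def localSum (U : ℕ) (G : ℤ → ENNReal) (j : ℤ) : ENNReal :=
  ∑ u ∈ Finset.Icc (-U : ℤ) U, G (j + u)

theorem le_localSum {U : ℕ} (G : ℤ → ENNReal) {i j : ℤ} (h : |i - j| ≤ U) :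
    G i ≤ localSum U G j := by
  have h1 : i - j ∈ Finset.Icc (-U : ℤ) U := by
    rw [Finset.mem_Icc]
    exact abs_le.1 h
  calc G i = G (j + (i - j)) := by congr 1; ring
    _ ≤ _ := Finset.single_le_sum (f := fun u => G (j + u)) (fun _ _ => zero_le) h1

theorem tsum_localSum_sq_le (U : ℕ) (G : ℤ → ENNReal) :
    ∑' j, localSum U G j ^ 2 ≤ ((2 * U + 1) ^ 2 : ℕ) * ∑' j, G j ^ 2 := by
  have hcard : (Finset.Icc (-U : ℤ) U).card = 2 * U + 1 := by
    rw [Int.card_Icc]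
    omega
  calc _ ≤ ∑' j, ((2 * U + 1 : ℕ) : ENNReal) * ∑ u ∈ Finset.Icc (-U : ℤ) U, G (j + u) ^ 2 := by
        refine ENNReal.tsum_le_tsum fun j => ?_
        rw [← hcard]
        exact ENNReal.sq_sum_le_card_mul_sum_sq _ _
    _ = ((2 * U + 1 : ℕ) : ENNReal) * ∑ u ∈ Finset.Icc (-U : ℤ) U, ∑' j, G (j + u) ^ 2 := by
        rw [ENNReal.tsum_mul_left, Summable.tsum_finsetSum fun _ _ => ENNReal.summable]
    _ = ((2 * U + 1 : ℕ) : ENNReal) * ∑ u ∈ Finset.Icc (-U : ℤ) U, ∑' j, G j ^ 2 := by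
        congr 1
        refine Finset.sum_congr rfl fun u _ => ?_
        exact (Equiv.addRight u).tsum_eq fun j => G j ^ 2
    _ = _ := by
        rw [Finset.sum_const, hcard, nsmul_eq_mul]
        push_cast
        ring

/-- Walk from `j` to the known entry at `j + n * K`: at most `N` steps cost two block sums each, and
the known entry costs one more term. The centre `x` is kept apart from `j` so that neighbours of `x`
can be bounded by the same local sum. -/
theorem enorm_le_localSum_of_hit {K N U : ℕ} {v : ℤ → ℂ} {G : ℤ → ENNReal}
    (hT : ∀ j, ‖blockSum K v j‖ₑ ≤ G j) {J : Set ℤ} (hJ : ∀ j ∈ J, ‖v j‖ₑ ≤ G j) {j x n : ℤ}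
    (hn : |n| ≤ N) (hj : j + n * K ∈ J) (hx : |j - x| + (N * K + 1) ≤ U) :
    ‖v j‖ₑ ≤ (2 * N + 1 : ℕ) * localSum U G x := by
  have key : ∀ (y : ℤ) (r : ℕ), r ≤ N → (∀ i : ℕ, i < r → |y + i * K - j| ≤ N * K) →
      ‖v (y + r * K) - v y‖ₑ ≤ (2 * N : ℕ) * localSum U G x := by
    intro y r hr hy
    refine (enorm_sub_le_sum_blockSum K v y r).trans ?_
    calc _ ≤ ∑ i ∈ Finset.range r, 2 * localSum U G x := by
          refine Finset.sum_le_sum fun i hi => ?_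
          rw [two_mul]
          have h := abs_le.1 (hy i (Finset.mem_range.1 hi))
          have h2 := abs_le.1 (le_refl |j - x|)
          refine add_le_add ((hT _).trans (le_localSum G ?_)) ((hT _).trans (le_localSum G ?_))
          · rw [abs_le]; constructor <;> linarith
          · rw [abs_le]; constructor <;> linarith
      _ = (2 * r : ℕ) * localSum U G x := by
          rw [Finset.sum_const, Finset.card_range, nsmul_eq_mul]
          push_cast
          ring
      _ ≤ _ := by gcongr
  have hK : (0 : ℤ) ≤ K := Int.natCast_nonneg K
  have habs := abs_le.1 hn
  have hv : ‖v (j + n * K)‖ₑ ≤ localSum U G x := by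
    refine (hJ _ hj).trans (le_localSum G ?_)
    have h2 := abs_le.1 (le_refl |j - x|)
    rw [abs_le]
    constructor <;> nlinarith
  have hd : ‖v j - v (j + n * K)‖ₑ ≤ (2 * N : ℕ) * localSum U G x := by
    rcases le_total 0 n with h0 | h0
    · obtain ⟨r, rfl⟩ := Int.eq_ofNat_of_zero_le h0
      rw [← enorm_neg, neg_sub]
      refine key j r (by omega) fun i hi => ?_
      have h3 : (i : ℤ) * K ≤ N * K := by gcongr; omega
      have h4 : 0 ≤ (i : ℤ) * K := by positivity
      rw [add_sub_cancel_left, abs_le]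
      constructor <;> linarith
    · obtain ⟨r, hr⟩ := Int.eq_ofNat_of_zero_le (neg_nonneg.2 h0)
      have hj' : j = j + n * K + r * K := by rw [← hr]; ring
      have h := key (j + n * K) r (by omega) fun i hi => ?_
      · rwa [← hj'] at h
      · have h3 : (r - i : ℤ) * K ≤ N * K := by gcongr; omega
        have h4 : 0 ≤ (r - i : ℤ) * K := mul_nonneg (by omega) hK
        have h5 : j + n * K + i * K - j = -((r - i : ℤ) * K) := by
          rw [← hr]; ring
        rw [h5, abs_neg, abs_le]
        constructor <;> linarith
  calc ‖v j‖ₑ = ‖(v j - v (j + n * K)) + v (j + n * K)‖ₑ := by rw [sub_add_cancel]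
    _ ≤ ‖v j - v (j + n * K)‖ₑ + ‖v (j + n * K)‖ₑ := enorm_add_le _ _
    _ ≤ (2 * N : ℕ) * localSum U G x + localSum U G x := add_le_add hd hv
    _ = _ := by push_cast; ring

/-- `J` meets, within `N` steps of length `K`, every class modulo `K` with at most one exception. -/
def MeetsClasses (K N : ℕ) (J : Set ℤ) : Prop :=
  ∀ j : ℤ, (∃ n : ℤ, |n| ≤ N ∧ j + n * K ∈ J) ∨
    ∀ i : ℕ, 0 < i → i < K → ∃ n : ℤ, |n| ≤ N ∧ j + i + n * K ∈ J

/-- Either the class of `j` is met, and walking to the hit bounds `v j`, or all other classes are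
met, and `v j` is its block sum minus the other entries of the block, each bounded by walking. -/
theorem MeetsClasses.tsum_sq_le {K N : ℕ} (hK : 0 < K) :
    ∃ C : ℕ, ∀ (J : Set ℤ) (v : ℤ → ℂ), MeetsClasses K N J →
      ∑' j, ‖v j‖ₑ ^ 2 ≤ C * (∑' j, ‖blockSum K v j‖ₑ ^ 2 + ∑' j : J, ‖v j‖ₑ ^ 2) := by
  classical
  -- The radius allows for an offset below `K` inside a block, `N` steps of length `K`, and the
  -- shift by one in the sliding identity. The constant `D` dominates the bounds from both
  -- alternatives.
  set U := K + (N * K + 1) with hU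
  set D := 1 + (K + 1) * (2 * N + 1) with hD
  refine ⟨D ^ 2 * ((2 * U + 1) ^ 2 * 2), fun J v hJ => ?_⟩
  set w : ℤ → ENNReal := J.indicator fun j => ‖v j‖ₑ with hw
  set G : ℤ → ENNReal := fun j => ‖blockSum K v j‖ₑ + w j with hG
  have hT : ∀ j, ‖blockSum K v j‖ₑ ≤ G j := fun j => le_self_add
  have hJG : ∀ j ∈ J, ‖v j‖ₑ ≤ G j := fun j hj => by
    simp [hG, hw, hj]
  have hv : ∀ j, ‖v j‖ₑ ≤ D * localSum U G j := by
    intro j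
    rcases hJ j with ⟨n, hn, hj⟩ | h
    · refine (enorm_le_localSum_of_hit (U := U) hT hJG hn hj (x := j) ?_).trans ?_
      · rw [sub_self, abs_zero, hU]; push_cast; omega
      · gcongr
        rw [hD]; nlinarith
    · obtain ⟨K', rfl⟩ : ∃ K', K = K' + 1 := ⟨K - 1, by omega⟩
      have h1 : v j = blockSum (K' + 1) v j - ∑ i ∈ Finset.range K', v (j + (i + 1 : ℕ)) := by
        rw [blockSum, Finset.sum_range_succ']
        simp
      have h2 : ∀ i ∈ Finset.range K', ‖v (j + (i + 1 : ℕ))‖ₑ ≤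
          (2 * N + 1 : ℕ) * localSum U G j := by
        intro i hi
        rw [Finset.mem_range] at hi
        obtain ⟨n, hn, hj⟩ := h (i + 1) (by omega) (by omega)
        refine enorm_le_localSum_of_hit (U := U) hT hJG hn hj ?_
        rw [add_sub_cancel_left, abs_of_nonneg (by positivity), hU]
        push_cast
        linarith [(by exact_mod_cast hi : (i : ℤ) < K')]
      have h3 : ‖blockSum (K' + 1) v j‖ₑ ≤ localSum U G j :=
        (hT j).trans (le_localSum G (by simp))
      calc ‖v j‖ₑ ≤ ‖blockSum (K' + 1) v j‖ₑ + ‖∑ i ∈ Finset.range K', v (j + (i + 1 : ℕ))‖ₑ := by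
            conv_lhs => rw [h1]
            exact enorm_sub_le
        _ ≤ localSum U G j + ∑ i ∈ Finset.range K', (2 * N + 1 : ℕ) * localSum U G j := by
            refine add_le_add h3 ((enorm_sum_le _ _).trans (Finset.sum_le_sum h2))
        _ = (1 + K' * (2 * N + 1) : ℕ) * localSum U G j := by
            rw [Finset.sum_const, Finset.card_range, nsmul_eq_mul]
            push_cast
            ring
        _ ≤ _ := by
            gcongr
            rw [hD]; nlinarith
  have hG2 : ∀ j, G j ^ 2 ≤ 2 * (‖blockSum K v j‖ₑ ^ 2 + w j ^ 2) := fun j =>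
    ENNReal.add_sq_le_two_mul _ _
  have hw2 : ∑' j, w j ^ 2 = ∑' j : J, ‖v j‖ₑ ^ 2 := by
    rw [tsum_subtype J fun j => ‖v j‖ₑ ^ 2]
    refine tsum_congr fun j => ?_
    by_cases hj : j ∈ J <;> simp [hw, hj]
  calc ∑' j, ‖v j‖ₑ ^ 2 ≤ ∑' j, (D : ENNReal) ^ 2 * localSum U G j ^ 2 := by
        refine ENNReal.tsum_le_tsum fun j => ?_
        rw [← mul_pow]
        gcongr
        exact hv j
    _ ≤ (D : ENNReal) ^ 2 * (((2 * U + 1) ^ 2 : ℕ) * ∑' j, G j ^ 2) := by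
        rw [ENNReal.tsum_mul_left]
        gcongr
        exact tsum_localSum_sq_le U G
    _ ≤ (D : ENNReal) ^ 2 * (((2 * U + 1) ^ 2 : ℕ) *
          (2 * (∑' j, ‖blockSum K v j‖ₑ ^ 2 + ∑' j : J, ‖v j‖ₑ ^ 2))) := by
        gcongr
        rw [← hw2, ← ENNReal.tsum_add, ← ENNReal.tsum_mul_left]
        exact ENNReal.tsum_le_tsum hG2
    _ = _ := by push_cast; ring

/-- A criterion for the frame property: all blocks of `K` indices are windows, and the entries that
are differences of two windows meet the classes modulo `K`. -/
theorem isGaborFrame_of_meetsClasses {a b c : ℝ} (ha : 0 < a) (hb : 0 < b) (hc : 0 < c)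
    {k K N : ℕ} (hK : 0 < K) (J : ℝ → Set ℤ) (h1 : ∀ t j, IsWindow a b c t K j)
    (h2 : ∀ t, ∀ j ∈ J t, IsWindow a b c t k (j - k) ∧ IsWindow a b c t (k + 1) (j - k))
    (h3 : ∀ t, MeetsClasses K N (J t)) :
    IsGaborFrame (idealWindow c) a b := by
  obtain ⟨C, hC⟩ := MeetsClasses.tsum_sq_le (N := N) hK
  refine isGaborFrame_of_fiber_bound ha hb hc (C := C * 5) fun t v => ?_
  have h4 : ∑' j, ‖blockSum K v j‖ₑ ^ 2 ≤ ∑' m, ‖windowSum a b c t m v‖ₑ ^ 2 := by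
    rw [← tsum_univ fun j => ‖blockSum K v j‖ₑ ^ 2]
    exact tsum_blockSum_sq_le hb (fun j _ => h1 t j) v
  have h5 := tsum_entry_sq_le hb (h2 t) v
  calc _ ≤ C * (∑' j, ‖blockSum K v j‖ₑ ^ 2 + ∑' j : J t, ‖v j‖ₑ ^ 2) := hC (J t) v (h3 t)
    _ ≤ C * (∑' m, ‖windowSum a b c t m v‖ₑ ^ 2 + 4 * ∑' m, ‖windowSum a b c t m v‖ₑ ^ 2) := by
        gcongr
    _ = _ := by push_cast; ring

/-! ### Orbits of the rotation by `b` modulo `a` -/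

/-- The indices `j` for which `t + j b` lies in `[α, α + L)` modulo `a`. -/
def hitSet (a b α L t : ℝ) : Set ℤ := {j | ∃ l : ℤ, t + j * b + l * a ∈ Set.Ico α (α + L)}

/-- Translate `x` by a multiple of `a` into `(α - a, α]`, then climb by steps of size `g`; at most
`⌈a / g⌉₊` of them are needed, whatever `x` and `α`. -/
theorem exists_uniform_return {a g : ℝ} (ha : 0 < a) (hg : 0 < g) (β : ℝ) {n₀ l₀ : ℤ}
    (h : g = n₀ * β + l₀ * a) :
    ∃ N : ℕ, ∀ x α : ℝ, ∃ n l : ℤ, |n| ≤ N ∧ x + n * β + l * a ∈ Set.Ico α (α + g) := by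
  refine ⟨⌈a / g⌉₊ * n₀.natAbs, fun x α => ?_⟩
  set l₁ := ⌊(α - x) / a⌋
  set y := x + l₁ * a with hy
  have h1 : (l₁ : ℝ) * a ≤ α - x := (le_div_iff₀ ha).1 (Int.floor_le _)
  have h2 : α - x < (l₁ + 1) * a := (div_lt_iff₀ ha).1 (Int.lt_floor_add_one _)
  set s := ⌈(α - y) / g⌉₊
  have h3 : α - y ≤ s * g := (div_le_iff₀ hg).1 (Nat.le_ceil _)
  have h4 : s * g < α - y + g := by
    have := Nat.ceil_lt_add_one (a := (α - y) / g) (div_nonneg (by linarith) hg.le)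
    have h5 := mul_lt_mul_of_pos_right this hg
    rwa [add_mul, one_mul, div_mul_cancel₀ _ hg.ne'] at h5
  have h5 : s ≤ ⌈a / g⌉₊ := by
    refine Nat.ceil_mono ?_
    gcongr
    linarith
  refine ⟨s * n₀, l₁ + s * l₀, ?_, ?_⟩
  · rw [abs_mul, Nat.abs_cast, Int.abs_eq_natAbs]
    exact_mod_cast Nat.mul_le_mul_right _ h5
  · have e : x + ((s * n₀ : ℤ) : ℝ) * β + ((l₁ + s * l₀ : ℤ) : ℝ) * a = y + s * g := by
      rw [hy, h]; push_cast; ring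
    rw [e]
    exact ⟨by linarith, by linarith⟩

theorem exists_meetsClasses_of_small {a b L : ℝ} (ha : 0 < a) {K : ℕ} (α : ℝ) {n₀ l₀ : ℤ}
    (h0 : 0 < n₀ * (K * b) + l₀ * a) (hL : n₀ * (K * b) + l₀ * a ≤ L) :
    ∃ N : ℕ, ∀ t, MeetsClasses K N (hitSet a b α L t) := by
  obtain ⟨N, hN⟩ := exists_uniform_return ha h0 (K * b) rfl
  refine ⟨N, fun t j => Or.inl ?_⟩
  obtain ⟨n, l, hn, h1, h2⟩ := hN (t + j * b) α
  refine ⟨n, hn, l, ?_⟩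
  have e : t + ((j + n * K : ℤ) : ℝ) * b + l * a = t + j * b + n * (K * b) + l * a := by
    push_cast; ring
  rw [e]
  exact ⟨h1, by linarith⟩

theorem exists_int_combination {K p q : ℕ} (hpq : p.Coprime q) :
    ∃ n₀ l₀ : ℤ, n₀ * (K * q) + l₀ * p = (K.gcd p : ℕ) := by
  refine ⟨(K * q).gcdA p, (K * q).gcdB p, ?_⟩
  rw [← Nat.Coprime.gcd_mul_right_cancel K hpq.symm, Nat.gcd_eq_gcd_ab]
  push_cast
  ring

theorem exists_meetsClasses_of_gcd_le {h L : ℝ} (hh : 0 < h) {K p q : ℕ} (hK : 0 < K)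
    (hp : 0 < p) (hpq : p.Coprime q) (α : ℝ) (hL : K.gcd p * h ≤ L) :
    ∃ N : ℕ, ∀ t, MeetsClasses K N (hitSet (p * h) (q * h) α L t) := by
  obtain ⟨n₀, l₀, h1⟩ := exists_int_combination (K := K) hpq
  have e : n₀ * (K * (q * h)) + l₀ * (p * h) = K.gcd p * h := by
    have : (n₀ * (K * q) + l₀ * p : ℝ) = K.gcd p := by exact_mod_cast h1
    rw [← this]; ring
  have hd : 0 < K.gcd p := Nat.gcd_pos_of_pos_left _ hK
  refine exists_meetsClasses_of_small (by positivity) α (n₀ := n₀) (l₀ := l₀) ?_ (e.trans_le hL)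
  rw [e]
  positivity

/-- Every class returns to `[α, α + K h)`, where the part outside the target has length at most `h`.
Two classes both landing there would have to coincide. -/
theorem exists_meetsClasses_of_dvd {h L : ℝ} (hh : 0 < h) {K p q : ℕ} (hK : 0 < K)
    (hp : 0 < p) (hpq : p.Coprime q) (α : ℝ) (hKp : K ∣ p) (hL : (K - 1) * h ≤ L) :
    ∃ N : ℕ, ∀ t, MeetsClasses K N (hitSet (p * h) (q * h) α L t) := by
  obtain ⟨n₀, l₀, h1⟩ := exists_int_combination (K := K) hpq
  rw [Nat.gcd_eq_left hKp] at h1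
  have e : (K * h : ℝ) = n₀ * (K * (q * h)) + l₀ * (p * h) := by
    have : (n₀ * (K * q) + l₀ * p : ℝ) = K := by exact_mod_cast h1
    conv_lhs => rw [← this]
    ring
  have hp' : (0 : ℝ) < p * h := by positivity
  obtain ⟨N, hN⟩ := exists_uniform_return hp' (by positivity : 0 < K * h) (K * (q * h)) e
  refine ⟨N, fun t j => ?_⟩
  obtain ⟨n, l, hn, h2, h3⟩ := hN (t + j * (q * h)) α
  by_cases h4 : t + j * (q * h) + n * (K * (q * h)) + l * (p * h) < α + L
  · refine Or.inl ⟨n, hn, l, ?_⟩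
    push_cast
    exact ⟨by linarith, by linarith⟩
  refine Or.inr fun i hi hiK => ?_
  obtain ⟨n', l', hn', h5, h6⟩ := hN (t + (j + i) * (q * h)) α
  by_cases h7 : t + (j + i) * (q * h) + n' * (K * (q * h)) + l' * (p * h) < α + L
  · refine ⟨n', hn', l', ?_⟩
    push_cast
    exact ⟨by linarith, by linarith⟩
  exfalso
  push Not at h4 h7
  -- The two landing points differ by `z h` with `|z h| < h`, so `z = 0`; since `K ∣ p`, this forces
  -- `K ∣ i * q`, impossible for `0 < i < K` with `K` coprime to `q`.
  set z : ℤ := i * q + (n' - n) * (K * q) + (l' - l) * p with hz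
  have hz' : (z : ℝ) * h = (t + (j + i) * (q * h) + n' * (K * (q * h)) + l' * (p * h)) -
      (t + j * (q * h) + n * (K * (q * h)) + l * (p * h)) := by
    rw [hz]; push_cast; ring
  have hz1 : (z : ℝ) * h < 1 * h := by linarith
  have hz2 : ((-1 : ℤ) : ℝ) * h < z * h := by push_cast; linarith
  have hz3 : z < 1 := by exact_mod_cast lt_of_mul_lt_mul_right hz1 hh.le
  have hz4 : -1 < z := by exact_mod_cast lt_of_mul_lt_mul_right hz2 hh.le
  have hz5 : z = 0 := by omega
  obtain ⟨r, hr⟩ := hKp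
  have hdvd : (K : ℤ) ∣ i * q := ⟨-((n' - n) * q + (l' - l) * r), by
    have : (p : ℤ) = K * r := by exact_mod_cast hr
    rw [hz, this] at hz5
    linear_combination hz5⟩
  have hdvd' : K ∣ i * q := by exact_mod_cast hdvd
  have hcop : K.Coprime q := Nat.Coprime.coprime_dvd_left ⟨r, hr⟩ hpq
  exact absurd (Nat.le_of_dvd hi (hcop.dvd_of_dvd_mul_right hdvd')) (by omega)

/-- A subgroup of `ℝ` is dense or cyclic; in the cyclic case `K b` and `a` are integer multiples of
one number. -/
theorem rational_or_exists_small {a b : ℝ} (ha : 0 < a) (hb : 0 < b) {K : ℕ} (hK : 0 < K) :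
    (∃ p q : ℕ, 0 < p ∧ 0 < q ∧ p.Coprime q ∧ a / b = p / q) ∨
      ∀ L : ℝ, 0 < L → ∃ n l : ℤ, 0 < n * (K * b) + l * a ∧ n * (K * b) + l * a ≤ L := by
  rcases AddSubgroup.dense_or_cyclic (AddSubgroup.closure {(K * b : ℝ), a}) with h | ⟨g, hg⟩
  · right
    intro L hL
    obtain ⟨x, hx, hx1, hx2⟩ := h.exists_between hL
    rw [SetLike.mem_coe, AddSubgroup.mem_closure_pair] at hx
    obtain ⟨n, l, rfl⟩ := hx
    rw [zsmul_eq_mul, zsmul_eq_mul] at hx1 hx2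
    exact ⟨n, l, hx1, hx2.le⟩
  · left
    have h1 : (K * b : ℝ) ∈ AddSubgroup.closure {g} := by
      rw [← hg]; exact AddSubgroup.subset_closure (by simp)
    have h2 : a ∈ AddSubgroup.closure {g} := by
      rw [← hg]; exact AddSubgroup.subset_closure (by simp)
    rw [AddSubgroup.mem_closure_singleton] at h1 h2
    obtain ⟨m, hm⟩ := h1
    obtain ⟨n, hn⟩ := h2
    rw [zsmul_eq_mul] at hm hn
    have hK' : (0 : ℝ) < K := by exact_mod_cast hK
    have hg0 : g ≠ 0 := by rintro rfl; simp at hn; linarith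
    have hm0 : (m : ℝ) ≠ 0 := by
      intro h0
      rw [h0, zero_mul] at hm
      have : 0 < K * b := by positivity
      linarith
    set r : ℚ := n * K / m with hr
    have hr' : a / b = r := by
      have hb' : b = m * g / K := by rw [hm]; field_simp
      rw [hr, ← hn, hb']
      push_cast
      field_simp
    have hrpos : 0 < r := by
      have : (0 : ℝ) < r := by rw [← hr']; positivity
      exact_mod_cast this
    have hnum : 0 < r.num := Rat.num_pos.2 hrpos
    refine ⟨r.num.natAbs, r.den, by omega, r.pos, r.reduced, ?_⟩
    rw [hr']
    have h3 : ((r.num.natAbs : ℕ) : ℝ) = (r.num : ℝ) := by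
      rw [← Int.cast_natCast, Int.natAbs_of_nonneg hnum.le]
    rw [h3]
    exact Rat.cast_def r

theorem eq_mul_div_of_div_eq {a b : ℝ} (hb : 0 < b) {p q : ℕ} (hq : 0 < q)
    (h : a / b = p / q) : a = p * (b / q) ∧ b = q * (b / q) := by
  have hq' : (q : ℝ) ≠ 0 := by exact_mod_cast hq.ne'
  constructor
  · rw [div_eq_div_iff hb.ne' hq'] at h
    field_simp
    linarith
  · field_simp

/-- The arithmetic obstruction to the frame property. -/
def Obstruction (a b L : ℝ) (K : ℕ) : Prop :=
  ∃ p q : ℕ, 0 < p ∧ 0 < q ∧ p.Coprime q ∧ a / b = p / q ∧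
    (L < K.gcd p * (b / q) ∧ K.gcd p ≠ K ∨ L < K.gcd p * (b / q) - b / q ∧ K.gcd p = K)

theorem exists_meetsClasses_or_obstruction {a b L : ℝ} (ha : 0 < a) (hb : 0 < b) (hL : 0 < L)
    {K : ℕ} (hK : 0 < K) (α : ℝ) :
    (∃ N : ℕ, ∀ t, MeetsClasses K N (hitSet a b α L t)) ∨ Obstruction a b L K := by
  rcases rational_or_exists_small ha hb hK with ⟨p, q, hp, hq, hpq, hab⟩ | h
  · obtain ⟨hap, hbq⟩ := eq_mul_div_of_div_eq hb hq hab
    have hh : 0 < b / q := by positivity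
    by_cases hd : K.gcd p = K
    · by_cases hL' : (K - 1) * (b / q) ≤ L
      · left
        have := exists_meetsClasses_of_dvd hh hK hp hpq α (Nat.gcd_eq_left_iff_dvd.1 hd) hL'
        rwa [← hap, ← hbq] at this
      · right
        refine ⟨p, q, hp, hq, hpq, hab, Or.inr ⟨?_, hd⟩⟩
        rw [hd]
        linarith
    · by_cases hL' : K.gcd p * (b / q) ≤ L
      · left
        have := exists_meetsClasses_of_gcd_le hh hK hp hpq α hL'
        rwa [← hap, ← hbq] at this
      · exact Or.inr ⟨p, q, hp, hq, hpq, hab, Or.inl ⟨not_le.1 hL', hd⟩⟩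
  · obtain ⟨n, l, h0, h1⟩ := h L hL
    exact Or.inl (exists_meetsClasses_of_small ha α h0 h1)

/-- Two distinct classes modulo `K` are missed by the sets `J t`, for all `t` in an interval. -/
def MissesTwoClasses (b : ℝ) (K : ℕ) (J : ℝ → Set ℤ) : Prop :=
  ∃ (e₁ e₂ : ℝ) (i₀ i₁ : ℤ), e₁ < e₂ ∧ e₂ ≤ e₁ + b ∧ ¬ (K : ℤ) ∣ i₀ - i₁ ∧
    ∀ t ∈ Set.Ioo e₁ e₂, ∀ j ∈ J t, ¬ (K : ℤ) ∣ j - i₀ ∧ ¬ (K : ℤ) ∣ j - i₁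

theorem missesTwoClasses_hitSet_zero {b : ℝ} (hb : 0 < b) (a α : ℝ) {K : ℕ} (hK : 2 ≤ K) :
    MissesTwoClasses b K (hitSet a b α 0) := by
  refine ⟨0, b, 1, 0, hb, by simp, ?_, ?_⟩
  · intro h
    have := Int.le_of_dvd (by norm_num) h
    omega
  · rintro t - j ⟨l, h1, h2⟩
    linarith

/-- Modulo `d h`, every point of the orbit is congruent to `t + r h`, which lies in the gap `(α + L,
α + d h)`. -/
theorem notMem_hitSet {h L α t : ℝ} (hh : 0 < h) {d p q : ℕ} (hd : d ∣ p) {j r : ℤ}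
    (hj : (d : ℤ) ∣ j * q - r) (ht : α + L < t + r * h) (ht' : t + r * h < α + d * h) :
    j ∉ hitSet (p * h) (q * h) α L t := by
  rintro ⟨l, h1, h2⟩
  obtain ⟨x, hx⟩ := hj
  obtain ⟨y, rfl⟩ := hd
  have e : t + j * (q * h) + l * ((d * y : ℕ) * h) = t + r * h + ((x + l * y : ℤ) : ℝ) * (d * h) := by
    have : (j * q - r : ℝ) = d * x := by exact_mod_cast hx
    push_cast
    linear_combination h * this
  rw [e] at h1 h2
  rcases Nat.eq_zero_or_pos d with rfl | hd0
  · simp at *; linarith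
  have hdh : 0 < d * h := by positivity
  have h3 : ((x + l * y : ℤ) : ℝ) * (d * h) < ((0 : ℤ) : ℝ) * (d * h) := by
    push_cast at h2 ⊢; linarith
  have h4 : ((-1 : ℤ) : ℝ) * (d * h) < ((x + l * y : ℤ) : ℝ) * (d * h) := by
    push_cast at h1 ⊢; linarith
  have h5 : x + l * y < 0 := by exact_mod_cast lt_of_mul_lt_mul_right h3 hdh.le
  have h6 : -1 < x + l * y := by exact_mod_cast lt_of_mul_lt_mul_right h4 hdh.le
  omega

/-- If `d ≠ K`, the classes of `0` and `d` modulo `K` have the same orbit and both fall in the gap.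
If `d = K`, the class of the inverse of `q` modulo `K` is the orbit of `0` shifted by `b / q`, and
the gap, longer than `b / q`, holds both for suitable `t`. -/
theorem Obstruction.missesTwoClasses {a b L : ℝ} (hb : 0 < b) (hab : a < b) (hL : 0 ≤ L)
    {K : ℕ} (hK : 0 < K) (α : ℝ) (h : Obstruction a b L K) :
    MissesTwoClasses b K (hitSet a b α L) := by
  obtain ⟨p, q, hp, hq, hpq, hpq', h⟩ := h
  obtain ⟨hap, hbq⟩ := eq_mul_div_of_div_eq hb hq hpq'
  have hh : 0 < b / q := by positivity
  set d := K.gcd p with hd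
  have hdp : d ∣ p := Nat.gcd_dvd_right K p
  have hdK : d ∣ K := Nat.gcd_dvd_left K p
  have hd0 : 0 < d := Nat.gcd_pos_of_pos_left _ hK
  have hdh : d * (b / q) ≤ b := by
    have : (d : ℝ) ≤ p := by exact_mod_cast Nat.le_of_dvd hp hdp
    have : d * (b / q) ≤ p * (b / q) := by gcongr
    linarith
  have key : ∀ t ∈ Set.Ioo (α + L) (α + d * (b / q)), ∀ j : ℤ, (d : ℤ) ∣ j →
      j ∉ hitSet a b α L t := by
    intro t ht j hj
    have := notMem_hitSet (t := t) (α := α) (L := L) (q := q) (j := j) (r := 0) hh hdp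
      (by simpa using hj.mul_right _) (by simpa using ht.1) (by simpa using ht.2)
    rwa [← hap, ← hbq] at this
  have hdK' : (d : ℤ) ∣ K := by exact_mod_cast hdK
  rcases h with ⟨h1, h2⟩ | ⟨h1, h2⟩
  · refine ⟨α + L, α + d * (b / q), d, 0, by linarith, by linarith, ?_, fun t ht j hj => ⟨?_, ?_⟩⟩
    · rw [sub_zero]
      intro h3
      exact h2 (Nat.dvd_antisymm hdK (by exact_mod_cast h3))
    · intro h3
      exact key t ht j ((dvd_sub_left (dvd_refl _)).1 (hdK'.trans h3)) hj
    · intro h3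
      rw [sub_zero] at h3
      exact key t ht j (hdK'.trans h3) hj
  · have hcop : K.Coprime q := Nat.Coprime.coprime_dvd_left (h2 ▸ hdp) hpq
    obtain ⟨x, y, hxy⟩ : ∃ x y : ℤ, x * q - 1 = K * y := by
      refine ⟨K.gcdB q, -K.gcdA q, ?_⟩
      have := Nat.gcd_eq_gcd_ab K q
      rw [hcop.gcd_eq_one] at this
      push_cast at this
      linarith
    -- For `K = 1` the obstruction would read `L < 0`.
    have hK1 : K ≠ 1 := by
      intro h3
      rw [h2, h3] at h1
      push_cast at h1
      linarith
    refine ⟨α + L, α + (d * (b / q) - b / q), x, 0, by linarith, by linarith, ?_,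
      fun t ht j hj => ⟨?_, ?_⟩⟩
    · rw [sub_zero]
      intro h3
      have h4 : (K : ℤ) ∣ 1 := by
        have : (1 : ℤ) = x * q - K * y := by linarith
        rw [this]
        exact dvd_sub (h3.mul_right _) (dvd_mul_right _ _)
      exact hK1 (by simpa using Int.natAbs_dvd_natAbs.2 h4)
    · intro h3
      have h4 : (d : ℤ) ∣ j * q - 1 := by
        have : j * q - 1 = (j - x) * q + (x * q - 1) := by ring
        rw [this, hxy, h2]
        exact dvd_add (h3.mul_right _) (dvd_mul_right _ _)
      have := notMem_hitSet (t := t) (α := α) (L := L) (r := 1) hh hdp h4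
        (by push_cast; linarith [ht.1]) (by push_cast; linarith [ht.2])
      rw [← hap, ← hbq] at this
      exact this hj
    · intro h3
      rw [sub_zero] at h3
      exact key t ⟨ht.1, by linarith [ht.2]⟩ j (hdK'.trans h3) hj

/-! ### Null sequences of the fibers -/

theorem abs_sub_lt_of_mem_latticeWindow {a b c t : ℝ} {m i j : ℤ}
    (hi : i ∈ latticeWindow a b c t m) (hj : j ∈ latticeWindow a b c t m) :
    |i - j| < ⌈c / b⌉₊ := by
  have h := card_latticeWindow_le a b c t m
  rw [latticeWindow] at hi hj h
  rw [Int.card_Ico] at h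
  rw [Finset.mem_Ico] at hi hj
  rw [abs_lt]
  omega

/-- A frame admits no bounded null sequence of infinite energy common to the fibers over an
interval. -/
theorem not_isGaborFrame_of_null {a b c e₁ e₂ : ℝ} (ha : 0 < a) (hb : 0 < b) (he : e₁ < e₂)
    (heb : e₂ ≤ e₁ + b) {u : ℤ → ℂ} (hu : ∀ j, ‖u j‖ₑ ≤ 1) (hu' : ∑' j, ‖u j‖ₑ ^ 2 = ⊤)
    (h : ∀ t ∈ Set.Ioo e₁ e₂, ∀ m, windowSum a b c t m u = 0) :
    ¬ IsGaborFrame (idealWindow c) a b := by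
  classical
  intro hframe
  have hE : Set.Ioo e₁ e₂ ⊆ Set.Ioc e₁ (e₁ + b) := fun t ht => ⟨ht.1, ht.2.le.trans heb⟩
  obtain ⟨A, hA, hAM⟩ := hframe.fiber_bound hb measurableSet_Ioo hE (by simp [he])
  set W := ⌈c / b⌉₊ with hW
  set B := ⌈c / b⌉₊ * (⌈c / a⌉₊ + 1) with hB
  have key : ∀ N : ℕ, A * ∑ j ∈ Finset.Icc (-N : ℤ) N, ‖u j‖ₑ ^ 2 ≤
      ENNReal.ofReal b * (B * (2 * W : ℕ)) := by
    intro N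
    -- Truncate `u` to `v`, and let `w` be the part of `v` within `W` of the ends. Windows inside
    -- `[-N, N]` annihilate `v`; the others see `v` and `w` alike, and the energy of `w` is at most
    -- `2 W` for all `N`.
    set v : ℤ → ℂ := fun j => if |j| ≤ N then u j else 0 with hv
    set w : ℤ → ℂ := fun j => if |j| ≤ N ∧ N < |j| + W then u j else 0 with hw
    have hvN : ∀ j ∉ Finset.Icc (-N : ℤ) N, v j = 0 := by
      intro j hj
      refine if_neg fun h' => hj ?_
      rw [Finset.mem_Icc]
      exact abs_le.1 h'
    have hsum : ∑' j, ‖v j‖ₑ ^ 2 = ∑ j ∈ Finset.Icc (-N : ℤ) N, ‖u j‖ₑ ^ 2 := by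
      rw [tsum_eq_sum (s := Finset.Icc (-N : ℤ) N) fun j hj => by simp [hvN j hj]]
      refine Finset.sum_congr rfl fun j hj => ?_
      rw [Finset.mem_Icc] at hj
      simp only [hv]
      rw [if_pos (abs_le.2 hj)]
    have hwsum : ∑' j, ‖w j‖ₑ ^ 2 ≤ (2 * W : ℕ) := by
      set S := Finset.Ioc (N - W : ℤ) N ∪ Finset.Ico (-N : ℤ) (-N + W) with hS
      have hwS : ∀ j ∉ S, ‖w j‖ₑ ^ 2 = 0 := by
        intro j hj
        simp only [hw]
        rw [if_neg, enorm_zero, zero_pow two_ne_zero]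
        rintro ⟨h1, h2⟩
        apply hj
        rw [hS, Finset.mem_union, Finset.mem_Ioc, Finset.mem_Ico]
        rcases abs_cases j with ⟨h3, _⟩ | ⟨h3, _⟩ <;> rw [h3] at h1 h2 <;> omega
      rw [tsum_eq_sum hwS]
      calc _ ≤ ∑ j ∈ S, (1 : ENNReal) := by
            refine Finset.sum_le_sum fun j _ => ?_
            refine pow_le_one₀ zero_le ?_
            simp only [hw]
            split_ifs
            · exact hu j
            · simp
        _ = (S.card : ENNReal) := by simp
        _ ≤ _ := by
            gcongr
            refine (Finset.card_union_le _ _).trans ?_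
            rw [Int.card_Ioc, Int.card_Ico]
            omega
    rw [← hsum]
    refine hAM _ v _ hvN fun t ht => ?_
    refine le_trans (ENNReal.tsum_le_tsum fun m => ?_)
      ((tsum_windowSum_sq_le ha hb c t w).trans (by gcongr))
    by_cases hin : ∀ i ∈ latticeWindow a b c t m, |i| ≤ N
    · have : windowSum a b c t m v = windowSum a b c t m u :=
        Finset.sum_congr rfl fun i hi => if_pos (hin i hi)
      rw [this, h t ht m]
      simp
    · push Not at hin
      obtain ⟨i, hi, hiN⟩ := hin
      have : windowSum a b c t m v = windowSum a b c t m w := by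
        refine Finset.sum_congr rfl fun j hj => ?_
        simp only [hv, hw]
        have h1 := abs_sub_lt_of_mem_latticeWindow hi hj
        have h2 : |i| ≤ |i - j| + |j| := by
          simpa using abs_add_le (i - j) j
        have h3 : (N : ℤ) < |j| + W := by rw [hW]; omega
        simp [h3]
      rw [this]
  have htop : A * ∑' j, ‖u j‖ₑ ^ 2 ≤ ENNReal.ofReal b * (B * (2 * W : ℕ)) := by
    rw [ENNReal.tsum_eq_iSup_sum, ENNReal.mul_iSup]
    refine iSup_le fun S => le_trans ?_ (key (∑ j ∈ S, j.natAbs))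
    gcongr
    intro j hj
    have := Finset.single_le_sum (f := Int.natAbs) (fun _ _ => Nat.zero_le _) hj
    rw [Finset.mem_Icc]
    omega
  rw [hu', ENNReal.mul_top hA, top_le_iff] at htop
  exact ENNReal.mul_ne_top ENNReal.ofReal_ne_top
    (ENNReal.mul_ne_top (ENNReal.natCast_ne_top _) (ENNReal.natCast_ne_top _)) htop

/-- The indicator of the class of `r` modulo `K`. -/
noncomputable def classIndicator (K : ℕ) (r j : ℤ) : ℂ :=
  open Classical in if (K : ℤ) ∣ j - r then 1 else 0

theorem blockSum_classIndicator {K : ℕ} (hK : 0 < K) (r j : ℤ) :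
    blockSum K (classIndicator K r) j = 1 := by
  have hK' : (0 : ℤ) < K := by exact_mod_cast hK
  have h0 := Int.emod_nonneg (r - j) hK'.ne'
  have h1 := Int.emod_lt_of_pos (r - j) hK'
  have h2 := Int.emod_add_mul_ediv (r - j) K
  have hmem : ((r - j) % K).toNat ∈ Finset.range K := by
    rw [Finset.mem_range]; omega
  rw [blockSum, Finset.sum_eq_single_of_mem _ hmem]
  · rw [classIndicator, if_pos]
    exact ⟨-((r - j) / K), by rw [Int.toNat_of_nonneg h0]; linarith⟩
  · intro i hi hne
    rw [classIndicator, if_neg]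
    rintro ⟨x, hx⟩
    rw [Finset.mem_range] at hi
    apply hne
    have h3 : r - j = i + K * (-x) := by linarith
    rw [h3, Int.add_mul_emod_self_left, Int.emod_eq_of_lt (by omega) (by omega)]
    simp

/-- The difference of the two class indicators has zero `K`-block sums and vanishes on `J t`. Any
window that is not a `K`-block differs from one by the entry `j + k` in `J t`, so its sum is zero
too. -/
theorem MissesTwoClasses.not_isGaborFrame {a b c : ℝ} (ha : 0 < a) (hb : 0 < b) {k K : ℕ}
    (hK : 0 < K) {J : ℝ → Set ℤ} (hJ : MissesTwoClasses b K J)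
    (hwin : ∀ t m, ∃ j : ℤ, latticeWindow a b c t m = Finset.Ico j (j + K) ∨
      (j + k ∈ J t ∧ (K = k + 1 ∧ latticeWindow a b c t m = Finset.Ico j (j + k) ∨
        K = k ∧ latticeWindow a b c t m = Finset.Ico j (j + (k + 1 : ℕ))))) :
    ¬ IsGaborFrame (idealWindow c) a b := by
  obtain ⟨e₁, e₂, i₀, i₁, he, heb, hi, hJ⟩ := hJ
  set u : ℤ → ℂ := fun j => classIndicator K i₀ j - classIndicator K i₁ j with hu
  have hblock : ∀ j, blockSum K u j = 0 := by
    intro j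
    have h1 := blockSum_classIndicator hK i₀ j
    have h2 := blockSum_classIndicator hK i₁ j
    rw [blockSum] at h1 h2
    rw [blockSum, hu, Finset.sum_sub_distrib, h1, h2, sub_self]
  refine not_isGaborFrame_of_null ha hb he heb (u := u) ?_ ?_ ?_
  · intro j
    simp only [hu, classIndicator]
    split_ifs <;> simp
  · have hinj : Function.Injective fun n : ℤ => i₀ + n * K := by
      intro n n' h
      have hK' : (K : ℤ) ≠ 0 := by exact_mod_cast hK.ne'
      exact mul_right_cancel₀ hK' (add_left_cancel h)
    rw [eq_top_iff]
    refine le_trans (le_of_eq ?_) (ENNReal.tsum_comp_le_tsum_of_injective hinj _)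
    rw [← ENNReal.tsum_const_eq_top_of_ne_zero (α := ℤ) one_ne_zero]
    refine tsum_congr fun n => ?_
    have h2 : ¬ (K : ℤ) ∣ i₀ + n * K - i₁ := by
      intro h3
      apply hi
      have : i₀ - i₁ = (i₀ + n * K - i₁) - n * K := by ring
      rw [this]
      exact dvd_sub h3 (dvd_mul_left _ _)
    simp [hu, classIndicator, h2]
  · intro t ht m
    obtain ⟨j, h | ⟨hj, h⟩⟩ := hwin t m
    · rw [windowSum, h, sum_Ico_int_eq_blockSum, hblock]
    · have h0 : u (j + k) = 0 := by
        obtain ⟨h1, h2⟩ := hJ t ht _ hj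
        simp [hu, classIndicator, h1, h2]
      have h1 := blockSum_succ k u j
      rw [h0, add_zero] at h1
      rcases h with ⟨rfl, h⟩ | ⟨rfl, h⟩
      · rw [windowSum, h, sum_Ico_int_eq_blockSum, ← h1, hblock]
      · rw [windowSum, h, sum_Ico_int_eq_blockSum, h1, hblock]

/-! ### The windows of length `c = k b + c₀` -/

theorem exists_int_sub_mul_mem_Ico {a : ℝ} (ha : 0 < a) (x y : ℝ) :
    ∃ m : ℤ, x ≤ y - m * a ∧ y - m * a < x + a := by
  obtain ⟨m, h1, h2⟩ := (existsUnique_sub_zsmul_mem_Ico ha y x).exists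
  rw [zsmul_eq_mul] at h1 h2
  exact ⟨m, h1, h2⟩

theorem isWindow_of_lt {a b c₀ t : ℝ} (k : ℕ) {j m : ℤ} (hc₀ : c₀ < b)
    (h0 : 0 ≤ t + j * b - m * a) (h1 : t + j * b - m * a < c₀) :
    IsWindow a b (k * b + c₀) t (k + 1) j :=
  ⟨m, h0, by linarith, by push_cast; linarith, by push_cast; linarith⟩

theorem isWindow_of_ge {a b c₀ t : ℝ} (k : ℕ) {j m : ℤ} (hc₀ : 0 ≤ c₀)
    (h0 : c₀ ≤ t + j * b - m * a) (h1 : t + j * b - m * a < b) :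
    IsWindow a b (k * b + c₀) t k j :=
  ⟨m, by linarith, h1, by linarith, by linarith⟩

theorem exists_latticeWindow_eq {a b c₀ : ℝ} (hb : 0 < b) (k : ℕ) (hc₀ : 0 ≤ c₀) (hc₀b : c₀ < b)
    (t : ℝ) (m : ℤ) : ∃ j : ℤ,
      (c₀ ≤ t + j * b - m * a ∧ t + j * b - m * a < b ∧
        latticeWindow a b (k * b + c₀) t m = Finset.Ico j (j + k)) ∨
      (0 ≤ t + j * b - m * a ∧ t + j * b - m * a < c₀ ∧
        latticeWindow a b (k * b + c₀) t m = Finset.Ico j (j + (k + 1 : ℕ))) := by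
  obtain ⟨n, h0, h1⟩ := exists_int_sub_mul_mem_Ico hb 0 (t - m * a)
  have e : t - m * a - n * b = t + (-n : ℤ) * b - m * a := by push_cast; ring
  rw [e] at h0 h1
  refine ⟨-n, ?_⟩
  rcases le_or_gt c₀ (t + (-n : ℤ) * b - m * a) with h | h
  · exact Or.inl ⟨h, by linarith, latticeWindow_eq_Ico hb h0 (by linarith) (by linarith)
      (by linarith)⟩
  · exact Or.inr ⟨h0, h, latticeWindow_eq_Ico hb h0 (by linarith) (by push_cast; linarith)
      (by push_cast; linarith)⟩

/-- If `a ≤ c₀` then all blocks of length `k + 1` are windows. -/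
theorem isWindow_succ {a b c₀ : ℝ} (ha : 0 < a) (hac : a ≤ c₀) (hc₀b : c₀ < b) (k : ℕ)
    (t : ℝ) (j : ℤ) : IsWindow a b (k * b + c₀) t (k + 1) j := by
  obtain ⟨m, h0, h1⟩ := exists_int_sub_mul_mem_Ico ha 0 (t + j * b)
  exact isWindow_of_lt k hc₀b h0 (by linarith)

/-- If `c₀ ≤ b - a` then all blocks of length `k` are windows. -/
theorem isWindow_self {a b c₀ : ℝ} (ha : 0 < a) (hc₀ : 0 ≤ c₀) (hca : c₀ ≤ b - a) (k : ℕ)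
    (t : ℝ) (j : ℤ) : IsWindow a b (k * b + c₀) t k j := by
  obtain ⟨m, h0, h1⟩ := exists_int_sub_mul_mem_Ico ha (b - a) (t + j * b)
  exact isWindow_of_ge k hc₀ (by linarith) (by linarith)

theorem isGaborFrame_of_le_of_le {a b c₀ : ℝ} (ha : 0 < a) (hab : a < b) (k : ℕ)
    (hac : a ≤ c₀) (hca : c₀ ≤ b - a) : IsGaborFrame (idealWindow (k * b + c₀)) a b := by
  have hb : 0 < b := ha.trans hab
  have hc₀ : 0 < c₀ := ha.trans_le hac
  -- Blocks of both lengths start at every index, so every entry is known and no steps are needed.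
  refine isGaborFrame_of_meetsClasses ha hb (by positivity) (k := k) (K := k + 1) (N := 0)
    (Nat.succ_pos k) (fun _ => Set.univ) (fun t j => isWindow_succ ha hac (by linarith) k t j)
    (fun t j _ => ⟨isWindow_self ha (by linarith) hca k t _,
      isWindow_succ ha hac (by linarith) k t _⟩)
    fun t j => Or.inl ⟨0, by simp, trivial⟩

/-- Here `K = k + 1`. A `k`-block starts at `j - k` when `t + (j - k) b - m a` lies in `[c₀, b)`, so
the hit interval starts at `k b + c₀` and has length `b - c₀`. -/
theorem not_isGaborFrame_iff_of_le {a b c₀ : ℝ} (ha : 0 < a) (hab : a < b) (k : ℕ)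
    (hac : a ≤ c₀) (hc₀b : c₀ < b) :
    ¬ IsGaborFrame (idealWindow (k * b + c₀)) a b ↔ Obstruction a b (b - c₀) (k + 1) := by
  have hb : 0 < b := ha.trans hab
  have hc₀ : 0 < c₀ := ha.trans_le hac
  constructor
  · intro h
    rcases exists_meetsClasses_or_obstruction ha hb (sub_pos.2 hc₀b) (Nat.succ_pos k)
      (k * b + c₀) with ⟨N, hN⟩ | h'
    · refine absurd (isGaborFrame_of_meetsClasses ha hb (by positivity) (k := k) (Nat.succ_pos k) _
        (fun t j => isWindow_succ ha hac hc₀b k t j) (fun t j hj => ⟨?_,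
          isWindow_succ ha hac hc₀b k t _⟩) hN) h
      obtain ⟨l, h1, h2⟩ := hj
      refine isWindow_of_ge (m := -l) k hc₀.le ?_ ?_ <;> push_cast <;> linarith
    · exact h'
  · intro h
    refine (h.missesTwoClasses hb hab (by linarith) (Nat.succ_pos k) (k * b + c₀)).not_isGaborFrame
      (k := k) ha hb (Nat.succ_pos k) fun t m => ?_
    obtain ⟨j, ⟨h1, h2, h3⟩ | ⟨h1, h2, h3⟩⟩ := exists_latticeWindow_eq hb k hc₀.le hc₀b t m
    · refine ⟨j, Or.inr ⟨⟨-m, ?_, ?_⟩, Or.inl ⟨rfl, h3⟩⟩⟩ <;> push_cast <;> linarith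
    · exact ⟨j, Or.inl h3⟩

/-- Here `K = k`, and the `k + 1`-blocks give the hit interval `[k b, k b + c₀)`. For `c₀ = 0` it is
empty, so two classes are missed as soon as `2 ≤ k`. -/
theorem not_isGaborFrame_iff_of_le_sub {a b c₀ : ℝ} (ha : 0 < a) (hab : a < b) {k : ℕ}
    (hk : 0 < k) (hk' : c₀ = 0 → 2 ≤ k) (hc₀ : 0 ≤ c₀) (hca : c₀ ≤ b - a) :
    ¬ IsGaborFrame (idealWindow (k * b + c₀)) a b ↔ c₀ = 0 ∨ 0 < c₀ ∧ Obstruction a b c₀ k := by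
  have hb : 0 < b := ha.trans hab
  have hc₀b : c₀ < b := by linarith
  constructor
  · intro h
    rcases hc₀.eq_or_lt with h0 | h0
    · exact Or.inl h0.symm
    refine Or.inr ⟨h0, ?_⟩
    rcases exists_meetsClasses_or_obstruction ha hb h0 hk (k * b) with ⟨N, hN⟩ | h'
    · refine absurd (isGaborFrame_of_meetsClasses ha hb (by positivity) (k := k) hk _
        (fun t j => isWindow_self ha hc₀ hca k t j) (fun t j hj => ⟨
          isWindow_self ha hc₀ hca k t _, ?_⟩) hN) h
      obtain ⟨l, h1, h2⟩ := hj
      refine isWindow_of_lt (m := -l) k hc₀b ?_ ?_ <;> push_cast <;> linarith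
    · exact h'
  · intro h
    have hmiss : MissesTwoClasses b k (hitSet a b (k * b) c₀) := by
      rcases h with rfl | ⟨h0, h⟩
      · exact missesTwoClasses_hitSet_zero hb a _ (hk' rfl)
      · exact h.missesTwoClasses hb hab hc₀ hk _
    refine hmiss.not_isGaborFrame (k := k) ha hb hk fun t m => ?_
    obtain ⟨j, ⟨h1, h2, h3⟩ | ⟨h1, h2, h3⟩⟩ := exists_latticeWindow_eq hb k hc₀ hc₀b t m
    · exact ⟨j, Or.inl h3⟩
    · refine ⟨j, Or.inr ⟨⟨-m, ?_, ?_⟩, Or.inr ⟨rfl, h3⟩⟩⟩ <;> push_cast <;> linarith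

theorem mainTheorem3 (a b c c₀ : ℝ) (k : ℕ) (ha : 0 < a) (hab : a < b) (hbc : b < c)
    (hk : k = ⌊c / b⌋₊) (hc₀ : c₀ = c - k * b) :
    (a ≤ c₀ → c₀ ≤ b - a → IsGaborFrame (idealWindow c) a b) ∧
    (a ≤ c₀ → b - a < c₀ →
      (¬ IsGaborFrame (idealWindow c) a b ↔
        ∃ p q : ℕ, 0 < p ∧ 0 < q ∧ Nat.Coprime p q ∧ a / b = p / q ∧
          ((b - Nat.gcd (k + 1) p * b / q < c₀ ∧ Nat.gcd (k + 1) p ≠ k + 1) ∨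
            (b - Nat.gcd (k + 1) p * b / q + b / q < c₀ ∧ Nat.gcd (k + 1) p = k + 1)))) ∧
    (c₀ < a → c₀ ≤ b - a →
      (¬ IsGaborFrame (idealWindow c) a b ↔
        c₀ = 0 ∨
        (∃ p q : ℕ, 0 < p ∧ 0 < q ∧ Nat.Coprime p q ∧ a / b = p / q ∧
          0 < c₀ ∧ c₀ < Nat.gcd k p * b / q ∧ Nat.gcd k p ≠ k) ∨
        (∃ p q : ℕ, 0 < p ∧ 0 < q ∧ Nat.Coprime p q ∧ a / b = p / q ∧
          0 < c₀ ∧ c₀ < Nat.gcd k p * b / q - b / q ∧ Nat.gcd k p = k))) := by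
  have hb : 0 < b := ha.trans hab
  have hcb : 0 ≤ c / b := (div_pos (hb.trans hbc) hb).le
  have hkc : k * b ≤ c := by
    rw [← le_div_iff₀ hb, hk]
    exact Nat.floor_le hcb
  have hck : c < (k + 1) * b := by
    rw [← div_lt_iff₀ hb, hk]
    exact Nat.lt_floor_add_one _
  have hc₀0 : 0 ≤ c₀ := by linarith
  have hc₀b : c₀ < b := by linarith
  have hk0 : 0 < k := by
    rw [hk, Nat.floor_pos, one_le_div hb]
    exact hbc.le
  -- With `k = 1` and `c₀ = 0` one would have `c = b`, against `b < c`.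
  have hk2 : c₀ = 0 → 2 ≤ k := by
    intro h
    by_contra h'
    have : k = 1 := by omega
    rw [this] at hc₀
    push_cast at hc₀
    linarith
  obtain rfl : c = k * b + c₀ := by linarith
  refine ⟨fun h1 h2 => isGaborFrame_of_le_of_le ha hab k h1 h2, fun h1 _ => ?_, fun _ h2 => ?_⟩
  · rw [not_isGaborFrame_iff_of_le ha hab k h1 hc₀b, Obstruction]
    refine exists_congr fun p => exists_congr fun q => ?_
    refine and_congr_right fun _ => and_congr_right fun _ => and_congr_right fun _ =>
      and_congr_right fun _ => or_congr (and_congr_left fun _ => ?_) (and_congr_left fun _ => ?_)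
    all_goals
      rw [mul_div_assoc]
      constructor <;> intro h <;> linarith
  · rw [not_isGaborFrame_iff_of_le_sub ha hab hk0 hk2 hc₀0 h2, Obstruction]
    refine or_congr_right ?_
    simp only [mul_div_assoc]
    constructor
    · rintro ⟨h0, p, q, hp, hq, hpq, e, ⟨h3, h4⟩ | ⟨h3, h4⟩⟩
      · exact Or.inl ⟨p, q, hp, hq, hpq, e, h0, h3, h4⟩
      · exact Or.inr ⟨p, q, hp, hq, hpq, e, h0, h3, h4⟩
    · rintro (⟨p, q, hp, hq, hpq, e, h0, h3, h4⟩ | ⟨p, q, hp, hq, hpq, e, h0, h3, h4⟩)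
      · exact ⟨h0, p, q, hp, hq, hpq, e, Or.inl ⟨h3, h4⟩⟩
      · exact ⟨h0, p, q, hp, hq, hpq, e, Or.inr ⟨h3, h4⟩⟩
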